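/- Let $A\in\mathbb{R}^{n\times n}$, $N\ge 1$, $H_i\in\mathbb{R}^{p_i\times n}$ for $i=1,\dots,N$, and $H=\mathrm{col}(H_1,\dots,H_N)$. Let $\mathcal{G}$ be a weighted directed graph on $\{1,\dots,N\}$ without self-loops, with adjacency matrix $[a_{ij}]$, where $a_{ji}>0$ if $(i,j)$ is an edge and $a_{ji}=0$ otherwise, and with Laplacian $\mathcal{L}=\mathrm{diag}\bigl(\sum_j a_{1j},\dots,\sum_j a_{Nj}\bigr)-[a_{ij}]$. Consider the plant $\dot x=Ax$, $y_i=H_ix$ $(i=1,\dots,N)$ and distributed observers of the form $$\dot{\hat x}_i=A\hat x_i+L_i(y_i-H_i\hat x_i)+\gamma r_iM_i\sum_{j=1}^N a_{ij}(\hat x_j-\hat x_i),\qquad i=1,\dots,N,\tag{obsl}$$ with $\hat x_i(t)\in\mathbb{R}^n$, gains $\gamma\in\mathbb{R}$, $L_i\in\mathbb{R}^{n\times p_i}$, $M_i\in\mathbb{R}^{n\times n}$, and $r=(r_1,\dots,r_N)$ the positive row vector with $r\mathcal{L}=0$ and $\sum_i r_i=N$. The observer achieves omniscience asymptotically if $\|\hat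 x_i(t)-x(t)\|\to0$ as $t\to\infty$ for all $i$ and all initial conditions. Its errors $e_i=\hat x_i-x$ obey the error system $\dot e_i=(A-L_iH_i)e_i+\gamma r_iM_i\sum_j a_{ij}(e_j-e_i)$, $i=1,\dots,N$; its solutions converge to zero with decay rate at least $\alpha$ if there is a constant $C$ such that $\|e(t)\|\le Ce^{-\alpha t}\|e(0)\|$ for every solution $e=\mathrm{col}(e_1,\dots,e_N)$ and all $t\ge0$. Write $\mathrm{Sym}(X)=X+X^T$, $R=\mathrm{diag}(r_1,\dots,r_N)$, and for symmetric matrices $X>Y$ if $X-Y$ is positive definite. **Theorem.** Let $\alpha>0$. If $(H,A)$ is observable and $\mathcal{G}$ is strongly connected, then there is a distributed observer of the form (obsl) that achieves omniscience asymptotically and for which all solutions of the error system converge to zero with decay rate at least $\alpha$. Such an observer is obtained by the following procedure: each step can be carried out, whatever choices were made in the preceding steps, and every outcome is such an observer. 1. For each $i$ choose $v_i\in\{0,\dots,n\}$ and an orthogonal matrix $T_i\in\mathbb{R}^{n\times n}$ such that $T_i^TAT_i=\begin{bmatrix}A_{io}&0\\A_{ir}&A_{iu}\end{bmatrix}$ and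 $H_iT_i=\begin{bmatrix}H_{io}&0\end{bmatrix}$, with $A_{io}\in\mathbb{R}^{v_i\times v_i}$, $H_{io}\in\mathbb{R}^{p_i\times v_i}$ and $(H_{io},A_{io})$ observable. 2. Compute the unique positive row vector $r$ with $r\mathcal{L}=0$ and $\sum_i r_i=N$. 3. Take $\epsilon>0$ such that $T^T\bigl((R\mathcal{L}+\mathcal{L}^TR)\otimes I_n\bigr)T+G>\epsilon I_{nN}$, where $T=\mathrm{diag}(T_1,\dots,T_N)$ and $G=\mathrm{diag}(G_1,\dots,G_N)$ with $G_i=\begin{bmatrix}I_{v_i}&0\\0&0_{n-v_i}\end{bmatrix}$. 4. Take $\gamma>0$ so large that $\gamma\epsilon>2\alpha$ and, for all $i$, $A_{iu}+A_{iu}^T-(\gamma\epsilon-2\alpha)I_{n-v_i}+\frac{1}{\gamma\epsilon-2\alpha}A_{ir}A_{ir}^T<0$ (this holds for all sufficiently large $\gamma$). 5. For each $i$ choose $L_{io}\in\mathbb{R}^{v_i\times p_i}$ such that all eigenvalues of $A_{io}-L_{io}H_{io}$ lie in $\{s\in\mathbb{C}:\mathrm{Re}(s)<-\alpha\}$. 6.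 For each $i$ take a positive definite solution $P_{io}$ of the Lyapunov equation $\mathrm{Sym}\bigl(P_{io}(A_{io}-L_{io}H_{io}+\alpha I_{v_i})\bigr)+(\gamma-2\alpha)I_{v_i}=0$. 7. Put $L_i=T_i\begin{bmatrix}L_{io}\\0\end{bmatrix}$ and $M_i=T_i\begin{bmatrix}P_{io}^{-1}&0\\0&I_{n-v_i}\end{bmatrix}T_i^T$. -/

import Mathlib

open Matrix
open scoped Kronecker

namespace DistObs

/-! ### Weighted digraphs -/

/-- A simple weighted digraph on the nodes `0, …, N - 1`, given by its adjacency matrix.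
The entry `weight j i` is the weight of the edge `(i, j)`; it is positive on the edges and
zero elsewhere. -/
structure WeightedDigraph (N : ℕ) where
  weight : Matrix (Fin N) (Fin N) ℝ
  weight_nonneg : ∀ i j, 0 ≤ weight i j
  weight_self : ∀ i, weight i i = 0

namespace WeightedDigraph

variable {N : ℕ}

/-- `(i, j)` is an edge (information flows from `i` to `j`). -/
def IsEdge (G : WeightedDigraph N) (i j : Fin N) : Prop := G.weight j i ≠ 0

/-- Any two distinct nodes are joined by a directed path. -/
def IsStronglyConnected (G : WeightedDigraph N) : Prop :=
  ∀ i j, i ≠ j → Relation.TransGen G.IsEdge i j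

/-- The Laplacian: the diagonal matrix of the row sums minus the adjacency matrix. -/
def laplacian (G : WeightedDigraph N) : Matrix (Fin N) (Fin N) ℝ :=
  Matrix.diagonal (fun i => ∑ j, G.weight i j) - G.weight

/-- `r` is a positive row vector with `r 𝓛 = 0` and `r 𝟏 = N`. -/
def IsNormalizedLeftNull (G : WeightedDigraph N) (r : Fin N → ℝ) : Prop :=
  (∀ i, 0 < r i) ∧ r ᵥ* G.laplacian = 0 ∧ ∑ i, r i = N

/-- `R 𝓛 + 𝓛ᵀ R` with `R = diag(r)`: the Laplacian of the mirror of the balanced graph. -/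
def mirrorLaplacian (G : WeightedDigraph N) (r : Fin N → ℝ) : Matrix (Fin N) (Fin N) ℝ :=
  Matrix.diagonal r * G.laplacian + G.laplacianᵀ * Matrix.diagonal r

end WeightedDigraph

/-! ### Observability -/

/-- The observability matrix `col(C, C A, …, C A ^ (n - 1))`. -/
def obsMatrix {m : Type*} {n : ℕ} (C : Matrix m (Fin n) ℝ) (A : Matrix (Fin n) (Fin n) ℝ) :
    Matrix (Fin n × m) (Fin n) ℝ :=
  Matrix.of fun ki j => (C * A ^ (ki.1 : ℕ)) ki.2 j

/-- The pair `(C, A)` is observable: the kernel of the observability matrix is trivial. -/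
def IsObservable {m : Type*} {n : ℕ} (C : Matrix m (Fin n) ℝ)
    (A : Matrix (Fin n) (Fin n) ℝ) : Prop :=
  LinearMap.ker (obsMatrix C A).mulVecLin = ⊥

/-- `col(H₁, …, H_N)`. -/
def stack {N n : ℕ} {p : Fin N → ℕ} (H : (i : Fin N) → Matrix (Fin (p i)) (Fin n) ℝ) :
    Matrix ((i : Fin N) × Fin (p i)) (Fin n) ℝ :=
  Matrix.of fun ik j => H ik.1 ik.2 j

/-- An orthogonal observability decomposition of `(H, A)`: an orthogonal matrix `T` with
`Tᵀ A T = [A_o, 0; A_r, A_u]`, `H T = [H_o, 0]` and `(H_o, A_o)` observable. -/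
structure ObsDecomp {p n : ℕ} (H : Matrix (Fin p) (Fin n) ℝ)
    (A : Matrix (Fin n) (Fin n) ℝ) where
  v : ℕ
  v_le : v ≤ n
  T : Matrix (Fin n) (Fin v ⊕ Fin (n - v)) ℝ
  orthogonal : T * Tᵀ = 1
  block_zero : (Tᵀ * A * T).toBlocks₁₂ = 0
  cols_zero : (H * T).toCols₂ = 0
  observable : IsObservable (H * T).toCols₁ (Tᵀ * A * T).toBlocks₁₁

namespace ObsDecomp

variable {p n : ℕ} {H : Matrix (Fin p) (Fin n) ℝ} {A : Matrix (Fin n) (Fin n) ℝ}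

/-- The block `A_o`. -/
def Ao (D : ObsDecomp H A) : Matrix (Fin D.v) (Fin D.v) ℝ := (D.Tᵀ * A * D.T).toBlocks₁₁

/-- The block `A_r`. -/
def Ar (D : ObsDecomp H A) : Matrix (Fin (n - D.v)) (Fin D.v) ℝ :=
  (D.Tᵀ * A * D.T).toBlocks₂₁

/-- The block `A_u`. -/
def Au (D : ObsDecomp H A) : Matrix (Fin (n - D.v)) (Fin (n - D.v)) ℝ :=
  (D.Tᵀ * A * D.T).toBlocks₂₂

/-- The block `H_o`. -/
def Ho (D : ObsDecomp H A) : Matrix (Fin p) (Fin D.v) ℝ := (H * D.T).toCols₁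

end ObsDecomp

/-! ### The observer and the error system -/

section Observer

variable {N n : ℕ} {p : Fin N → ℕ}

/-- `x` solves `ẋ = A x` on `[0, ∞)`. -/
def IsPlantSolution (A : Matrix (Fin n) (Fin n) ℝ) (x : ℝ → Fin n → ℝ) : Prop :=
  ∀ t, 0 ≤ t → HasDerivWithinAt x (A *ᵥ x t) (Set.Ici 0) t

/-- `xh` solves, on `[0, ∞)`, the distributed observer equations
`x̂ᵢ' = A x̂ᵢ + Lᵢ (yᵢ - Hᵢ x̂ᵢ) + γ rᵢ Mᵢ ∑ⱼ aᵢⱼ (x̂ⱼ - x̂ᵢ)` with `yᵢ = Hᵢ x`. -/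
def IsObserverSolution (A : Matrix (Fin n) (Fin n) ℝ)
    (H : (i : Fin N) → Matrix (Fin (p i)) (Fin n) ℝ) (G : WeightedDigraph N)
    (r : Fin N → ℝ) (γ : ℝ) (L : (i : Fin N) → Matrix (Fin n) (Fin (p i)) ℝ)
    (M : Fin N → Matrix (Fin n) (Fin n) ℝ)
    (x : ℝ → Fin n → ℝ) (xh : Fin N → ℝ → Fin n → ℝ) : Prop :=
  ∀ i t, 0 ≤ t → HasDerivWithinAt (xh i)
    (A *ᵥ xh i t + L i *ᵥ (H i *ᵥ x t - H i *ᵥ xh i t)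
      + (γ * r i) • (M i *ᵥ ∑ j, G.weight i j • (xh j t - xh i t))) (Set.Ici 0) t

/-- The distributed observer achieves omniscience asymptotically: `‖x̂ᵢ(t) - x(t)‖ → 0`
(Euclidean norm) for every node and all initial conditions of plant and observer. -/
def AchievesOmniscience (A : Matrix (Fin n) (Fin n) ℝ)
    (H : (i : Fin N) → Matrix (Fin (p i)) (Fin n) ℝ) (G : WeightedDigraph N)
    (r : Fin N → ℝ) (γ : ℝ) (L : (i : Fin N) → Matrix (Fin n) (Fin (p i)) ℝ)
    (M : Fin N → Matrix (Fin n) (Fin n) ℝ) : Prop :=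
  ∀ x xh, IsPlantSolution A x → IsObserverSolution A H G r γ L M x xh →
    ∀ i, Filter.Tendsto (fun t => ‖WithLp.toLp 2 (xh i t - x t)‖) Filter.atTop (nhds 0)

/-- The block diagonal matrix `diag(B₁, …, B_N)` of size `N n`. -/
def diagBlocks (B : Fin N → Matrix (Fin n) (Fin n) ℝ) :
    Matrix (Fin N × Fin n) (Fin N × Fin n) ℝ :=
  Matrix.of fun ik jl => if ik.1 = jl.1 then B ik.1 ik.2 jl.2 else 0

/-- The matrix `Λ - γ M̄ (R 𝓛 ⊗ Iₙ)` of the global error system, where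
`Λ = diag(A - L₁ H₁, …, A - L_N H_N)`, `M̄ = diag(M₁, …, M_N)` and `R = diag(r)`. -/
def errorMatrix (A : Matrix (Fin n) (Fin n) ℝ)
    (H : (i : Fin N) → Matrix (Fin (p i)) (Fin n) ℝ) (G : WeightedDigraph N)
    (r : Fin N → ℝ) (γ : ℝ) (L : (i : Fin N) → Matrix (Fin n) (Fin (p i)) ℝ)
    (M : Fin N → Matrix (Fin n) (Fin n) ℝ) : Matrix (Fin N × Fin n) (Fin N × Fin n) ℝ :=
  diagBlocks (fun i => A - L i * H i)
    - γ • (diagBlocks M * ((Matrix.diagonal r * G.laplacian) ⊗ₖ (1 : Matrix (Fin n) (Fin n) ℝ)))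

/-- All solutions of the global error system converge to zero with decay rate at least `α`:
for some constant `C`, `‖e(t)‖ ≤ C exp(-α t) ‖e(0)‖` for every solution `e` and `t ≥ 0`. -/
def ErrorsDecayAtRate (A : Matrix (Fin n) (Fin n) ℝ)
    (H : (i : Fin N) → Matrix (Fin (p i)) (Fin n) ℝ) (G : WeightedDigraph N)
    (r : Fin N → ℝ) (γ : ℝ) (L : (i : Fin N) → Matrix (Fin n) (Fin (p i)) ℝ)
    (M : Fin N → Matrix (Fin n) (Fin n) ℝ) (α : ℝ) : Prop :=
  ∃ C : ℝ, ∀ e : ℝ → Fin N × Fin n → ℝ,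
    (∀ t, 0 ≤ t → HasDerivWithinAt e (errorMatrix A H G r γ L M *ᵥ e t) (Set.Ici 0) t) →
    ∀ t, 0 ≤ t → ‖WithLp.toLp 2 (e t)‖ ≤ C * Real.exp (-α * t) * ‖WithLp.toLp 2 (e 0)‖

end Observer

/-! ### The design procedure -/

section Design

variable {N n : ℕ} {p : Fin N → ℕ} {A : Matrix (Fin n) (Fin n) ℝ}
  {H : (i : Fin N) → Matrix (Fin (p i)) (Fin n) ℝ}

/-- `Sym(M) = M + Mᵀ`. -/
def symPart {ι : Type*} (M : Matrix ι ι ℝ) : Matrix ι ι ℝ := M + Mᵀ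

/-- `T = diag(T₁, …, T_N)`. -/
def bigT (D : (i : Fin N) → ObsDecomp (H i) A) :
    Matrix (Fin N × Fin n) ((i : Fin N) × (Fin (D i).v ⊕ Fin (n - (D i).v))) ℝ :=
  (Matrix.blockDiagonal' fun i => (D i).T).submatrix
    (Equiv.sigmaEquivProd (Fin N) (Fin n)).symm id

/-- `G = diag(G₁, …, G_N)` with `Gᵢ = [gᵢ I, 0; 0, 0]` and `gᵢ = 1`. -/
def bigG (D : (i : Fin N) → ObsDecomp (H i) A) :
    Matrix ((i : Fin N) × (Fin (D i).v ⊕ Fin (n - (D i).v)))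
      ((i : Fin N) × (Fin (D i).v ⊕ Fin (n - (D i).v))) ℝ :=
  Matrix.blockDiagonal' fun i =>
    Matrix.fromBlocks (1 : Matrix (Fin (D i).v) (Fin (D i).v) ℝ) 0 0 0

/-- `ε > 0` and `Tᵀ ((R 𝓛 + 𝓛ᵀ R) ⊗ Iₙ) T + G > ε I`. -/
def EpsCondition (G : WeightedDigraph N) (r : Fin N → ℝ)
    (D : (i : Fin N) → ObsDecomp (H i) A) (ε : ℝ) : Prop :=
  0 < ε ∧
    ((bigT D)ᵀ * (G.mirrorLaplacian r ⊗ₖ (1 : Matrix (Fin n) (Fin n) ℝ)) * bigT D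
      + bigG D - ε • 1).PosDef

/-- The coupling gain `γ > 0` is so large that `γ ε > 2 α` and, for every node,
`A_u + A_uᵀ - (γ ε - 2 α) I + (γ ε - 2 α)⁻¹ A_r A_rᵀ < 0`. -/
def GammaCondition (D : (i : Fin N) → ObsDecomp (H i) A) (α ε γ : ℝ) : Prop :=
  0 < γ ∧ 2 * α < γ * ε ∧ ∀ i,
    (-((D i).Au + (D i).Auᵀ - (γ * ε - 2 * α) • 1
      + (1 / (γ * ε - 2 * α)) • ((D i).Ar * (D i).Arᵀ))).PosDef

/-- All complex eigenvalues of every `A_o - L_o H_o` have real part less than `-α`. -/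
def PoleCondition (D : (i : Fin N) → ObsDecomp (H i) A) (α : ℝ)
    (Lo : (i : Fin N) → Matrix (Fin (D i).v) (Fin (p i)) ℝ) : Prop :=
  ∀ i, ∀ s ∈ spectrum ℂ (((D i).Ao - Lo i * (D i).Ho).map (algebraMap ℝ ℂ)), s.re < -α

/-- Every `P_o` is positive definite and solves the Lyapunov equation
`Sym(P_o (A_o - L_o H_o + α I)) + (γ - 2 α) I = 0`. -/
def LyapunovCondition (D : (i : Fin N) → ObsDecomp (H i) A) (α γ : ℝ)
    (Lo : (i : Fin N) → Matrix (Fin (D i).v) (Fin (p i)) ℝ)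
    (Po : (i : Fin N) → Matrix (Fin (D i).v) (Fin (D i).v) ℝ) : Prop :=
  ∀ i, (Po i).PosDef ∧
    symPart (Po i * ((D i).Ao - Lo i * (D i).Ho + α • 1)) + (γ - 2 * α) • 1 = 0

/-- The output injection gains `Lᵢ = Tᵢ [L_o; 0]`. -/
def gainL (D : (i : Fin N) → ObsDecomp (H i) A)
    (Lo : (i : Fin N) → Matrix (Fin (D i).v) (Fin (p i)) ℝ) (i : Fin N) :
    Matrix (Fin n) (Fin (p i)) ℝ :=
  (D i).T * (Matrix.fromRows (Lo i) 0 : Matrix (Fin (D i).v ⊕ Fin (n - (D i).v)) (Fin (p i)) ℝ)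

/-- The coupling gain matrices `Mᵢ = Tᵢ diag(P_o⁻¹, I) Tᵢᵀ`. -/
noncomputable def gainM (D : (i : Fin N) → ObsDecomp (H i) A)
    (Po : (i : Fin N) → Matrix (Fin (D i).v) (Fin (D i).v) ℝ) (i : Fin N) :
    Matrix (Fin n) (Fin n) ℝ :=
  (D i).T * (Matrix.fromBlocks (Po i)⁻¹ 0 0 1 :
    Matrix (Fin (D i).v ⊕ Fin (n - (D i).v)) (Fin (D i).v ⊕ Fin (n - (D i).v)) ℝ) * (D i).Tᵀ

end Design

end DistObs

/-! The error system has a block-diagonal quadratic Lyapunov function. In the coordinates `z_i =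
T_iᵀ e_i = (x_i, y_i)`, observable part first, put `V = ∑ (x_iᵀ P_io x_i + |y_i|²)`. The gain `M_i`
is the inverse of the `i`-th block of `V`, so the coupling contributes exactly `-γ eᵀ((R𝓛 + 𝓛ᵀR) ⊗
I)e` to `V'`. What remains of `V' + 2αV` at node `i` is at most `γ(ε|z_i|² - |x_i|²)`, by the
Lyapunov equation, the condition on `γ` and a completed square for the cross term `A_ir`
(`local_dissipation`). The choice of `ε` says that these bounds sum to at most `γ` times the
coupling form. Hence `V' ≤ -2αV` (`errorsDecayAtRate_of_design`), and `norm_le_of_lyapunov` turns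
this into the decay estimate.

The steps can be carried out for the following reasons. The coupling form is nonnegative and, by
strong connectivity, vanishes only on consensus vectors; a consensus vector with no observable part
at any node is zero by joint observability, so `ε` exists (`exists_epsCondition`). Testing with a
nonzero consensus vector gives `ε < 1` for `n > 0`, whence `γ > γε > 2α` and the Lyapunov equation
of step 6 has a positive definite right-hand side. The injections `L_io` also come from a Lyapunov
equation (`exists_stabilizing_injection`), without pole placement.

Lyapunov equations are solved by means of trajectories: for a Hurwitz matrix every initial value
starts a solution tending to zero (`exists_stable_trajectory`), which gives uniqueness, then
existence by dimension, and the sign of the solution. -/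

namespace DistObs

/-! ### Hurwitz matrices and the Lyapunov equation. -/

section Lyapunov
open Filter Topology
variable {ι : Type*} [Fintype ι] [DecidableEq ι]

/-- On a vector killed by `N ^ (k + 1)` the truncated series is the whole exponential, and this
formula says that it solves the equation with matrix `N`. -/
theorem hasDerivAt_truncated_exp (N : Matrix ι ι ℂ) (x : ι → ℂ) (k : ℕ) (t : ℝ) :
    HasDerivAt (fun t : ℝ => ∑ j ∈ Finset.range (k + 1),
        ((t : ℂ) ^ j / (j.factorial : ℂ)) • (N ^ j *ᵥ x))
      (∑ j ∈ Finset.range k, ((t : ℂ) ^ j / (j.factorial : ℂ)) • (N ^ (j + 1) *ᵥ x)) t := by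
  induction k with
  | zero => simpa using hasDerivAt_const t x
  | succ k ih =>
    simp only [Finset.sum_range_succ _ (k + 1)]
    rw [Finset.sum_range_succ _ k]
    refine ih.add ?_
    have h1 : HasDerivAt (fun t : ℝ => (t : ℂ) ^ (k + 1) / ((k + 1).factorial : ℂ))
        ((t : ℂ) ^ k / (k.factorial : ℂ)) t := by
      have h := (((hasDerivAt_id t).ofReal_comp).pow (k + 1)).div_const ((k + 1).factorial : ℂ)
      refine h.congr_deriv ?_
      have : (k.factorial : ℂ) ≠ 0 := by exact_mod_cast k.factorial_ne_zero
      have : (k : ℂ) + 1 ≠ 0 := by exact_mod_cast k.succ_ne_zero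
      simp only [Nat.factorial_succ, Nat.cast_mul, Nat.cast_add, Nat.cast_one, id_eq,
        Complex.ofReal_one, mul_one, Nat.add_sub_cancel]
      field_simp
    exact h1.smul_const _

omit [Fintype ι] [DecidableEq ι] in
theorem tendsto_exp_mul_pow_smul {s : ℂ} (hs : s.re < 0) (j : ℕ) (x : ι → ℂ) :
    Tendsto (fun t : ℝ => Complex.exp (s * t) • (((t : ℂ) ^ j / (j.factorial : ℂ)) • x))
      atTop (𝓝 0) := by
  have h1 : Tendsto (fun t : ℝ => Complex.exp (s * t) * (t : ℂ) ^ j) atTop (𝓝 0) := by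
    rw [tendsto_zero_iff_norm_tendsto_zero]
    have h3 : Tendsto (fun t : ℝ => t ^ j * Real.exp (s.re * t)) atTop (𝓝 0) := by
      have h4 := isLittleO_pow_exp_pos_mul_atTop (b := -s.re) j (by linarith)
      refine h4.tendsto_div_nhds_zero.congr fun t => ?_
      rw [neg_mul, Real.exp_neg, div_inv_eq_mul]
    refine h3.congr' ?_
    filter_upwards [eventually_ge_atTop 0] with t ht
    rw [norm_mul, Complex.norm_exp, norm_pow, Complex.norm_real, Real.norm_of_nonneg ht]
    simp [mul_comm]
  have h2 := (h1.mul_const ((j.factorial : ℂ)⁻¹)).smul_const x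
  simp only [zero_mul, zero_smul] at h2
  refine h2.congr fun t => ?_
  rw [smul_smul]; congr 1; ring

/-- The initial values from which a solution of `ẏ = F y` converging to zero starts. -/
def stableSubspace (F : Matrix ι ι ℂ) : Submodule ℂ (ι → ℂ) where
  carrier := {x | ∃ y : ℝ → ι → ℂ, y 0 = x ∧ (∀ t, HasDerivAt y (F *ᵥ y t) t) ∧
    Tendsto y atTop (𝓝 0)}
  zero_mem' := ⟨fun _ => 0, rfl, fun t => by simpa using hasDerivAt_const t (0 : ι → ℂ),
    tendsto_const_nhds⟩
  add_mem' := by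
    rintro a b ⟨y, hy0, hy, hyt⟩ ⟨z, hz0, hz, hzt⟩
    refine ⟨y + z, by simp [hy0, hz0], fun t => ?_, by simpa only [add_zero] using! hyt.add hzt⟩
    simpa [mulVec_add] using (hy t).add (hz t)
  smul_mem' := by
    rintro c a ⟨y, hy0, hy, hyt⟩
    refine ⟨c • y, by simp [hy0], fun t => ?_, by simpa only [smul_zero] using! hyt.const_smul c⟩
    simpa [mulVec_smul] using (hy t).const_smul c

/-- On a generalized eigenvector the solution is `exp(s t)` times a polynomial in `t`, and the
exponential wins. -/
theorem mem_stableSubspace_of_pow_sub_mulVec_eq_zero {F : Matrix ι ι ℂ} {s : ℂ} (hs : s.re < 0)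
    {k : ℕ} {x : ι → ℂ} (hx : (F - s • 1) ^ k *ᵥ x = 0) : x ∈ stableSubspace F := by
  set M := F - s • (1 : Matrix ι ι ℂ) with hM
  have hk : M ^ (k + 1) *ᵥ x = 0 := by rw [pow_succ', ← mulVec_mulVec, hx, mulVec_zero]
  refine ⟨fun t => Complex.exp (s * t) • ∑ j ∈ Finset.range (k + 1),
        ((t : ℂ) ^ j / (j.factorial : ℂ)) • (M ^ j *ᵥ x), ?_, fun t => ?_, ?_⟩
  · simp [Finset.sum_range_succ']
  · have h1 : HasDerivAt (fun t : ℝ => Complex.exp (s * t)) (s * Complex.exp (s * t)) t := by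
      have h := (((hasDerivAt_id t).ofReal_comp).const_mul s).cexp
      refine h.congr_deriv ?_
      rw [id_eq, Complex.ofReal_one, mul_one, mul_comm]
    have h2 := h1.smul (hasDerivAt_truncated_exp M x k t)
    refine h2.congr_deriv ?_
    have hF : F = M + s • 1 := by simp [hM]
    have h3 : M *ᵥ (∑ j ∈ Finset.range (k + 1), ((t : ℂ) ^ j / (j.factorial : ℂ)) • (M ^ j *ᵥ x))
        = ∑ j ∈ Finset.range k, ((t : ℂ) ^ j / (j.factorial : ℂ)) • (M ^ (j + 1) *ᵥ x) := by
      rw [mulVec_sum, Finset.sum_range_succ]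
      simp only [mulVec_smul, mulVec_mulVec, ← pow_succ']
      rw [hk, smul_zero, add_zero]
    rw [mulVec_smul]
    conv_rhs => rw [hF]
    rw [add_mulVec, h3, smul_mulVec, one_mulVec, smul_add, smul_smul, mul_comm (Complex.exp _) s]
  · simp only [Finset.smul_sum]
    rw [← Finset.sum_const_zero (s := Finset.range (k + 1))]
    exact tendsto_finsetSum _ fun j _ => tendsto_exp_mul_pow_smul hs j _

/-- Over `ℂ` the generalized eigenspaces span the space, and each of them lies in the stable
subspace. -/
theorem stableSubspace_eq_top {F : Matrix ι ι ℂ} (hF : ∀ s ∈ spectrum ℂ F, s.re < 0) :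
    stableSubspace F = ⊤ := by
  rw [eq_top_iff, ← Module.End.iSup_maxGenEigenspace_eq_top (Matrix.toLin' F), iSup_le_iff]
  intro s x hx
  rw [Module.End.mem_maxGenEigenspace] at hx
  obtain ⟨k, hk⟩ := hx
  by_cases hx0 : x = 0
  · rw [hx0]; exact zero_mem _
  have hs : s ∈ spectrum ℂ F := by
    rw [← Matrix.spectrum_toLin']
    apply Module.End.HasEigenvalue.mem_spectrum
    apply Module.End.hasEigenvalue_of_hasGenEigenvalue (k := k)
    intro h
    apply hx0
    have : x ∈ Module.End.genEigenspace (Matrix.toLin' F) s k := by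
      rw [Module.End.mem_genEigenspace_nat]; exact hk
    rw [h] at this
    simpa using this
  refine mem_stableSubspace_of_pow_sub_mulVec_eq_zero (hF s hs) (k := k) ?_
  rw [← hk, ← Matrix.toLin'_apply, Matrix.toLin'_pow]
  congr 2
  simp [Module.End.one_eq_id]

theorem exists_stable_trajectory {F : Matrix ι ι ℝ}
    (hF : ∀ s ∈ spectrum ℂ (F.map (algebraMap ℝ ℂ)), s.re < 0) (x : ι → ℝ) :
    ∃ y : ℝ → ι → ℝ, y 0 = x ∧ (∀ t, HasDerivAt y (F *ᵥ y t) t) ∧ Tendsto y atTop (𝓝 0) := by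
  have hx : (fun i => (x i : ℂ)) ∈ stableSubspace (F.map (algebraMap ℝ ℂ)) := by
    rw [stableSubspace_eq_top hF]; trivial
  obtain ⟨y, hy0, hy, hyt⟩ := hx
  refine ⟨fun t i => (y t i).re, by ext i; simp [hy0], fun t => ?_, ?_⟩
  · rw [hasDerivAt_pi]
    intro i
    have h1 := hasDerivAt_pi.1 (hy t) i
    have h2 := Complex.reCLM.hasFDerivAt.comp_hasDerivAt t h1
    refine h2.congr_deriv ?_
    simp [mulVec, dotProduct]
  · rw [tendsto_pi_nhds] at hyt ⊢
    intro i
    simpa using! (Complex.continuous_re.tendsto _).comp (hyt i)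

omit [DecidableEq ι] in
theorem hasDerivAt_dotProduct_mulVec (P F : Matrix ι ι ℝ) {y z : ℝ → ι → ℝ} {t : ℝ}
    (hy : HasDerivAt y (F *ᵥ y t) t) (hz : HasDerivAt z (F *ᵥ z t) t) :
    HasDerivAt (fun t => y t ⬝ᵥ P *ᵥ z t) (y t ⬝ᵥ (P * F + Fᵀ * P) *ᵥ z t) t := by
  have hz' : HasDerivAt (fun t => P *ᵥ z t) (P *ᵥ (F *ᵥ z t)) t := by
    exact (P.mulVecLin.toContinuousLinearMap.hasFDerivAt).comp_hasDerivAt t hz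
  have h := HasDerivAt.fun_sum (u := Finset.univ)
    fun i _ => (hasDerivAt_pi.1 hy i).mul (hasDerivAt_pi.1 hz' i)
  refine h.congr_deriv ?_
  have e : y t ⬝ᵥ (P * F + Fᵀ * P) *ᵥ z t
      = (F *ᵥ y t) ⬝ᵥ (P *ᵥ z t) + y t ⬝ᵥ (P *ᵥ (F *ᵥ z t)) := by
    rw [add_mulVec, dotProduct_add, ← mulVec_mulVec, ← mulVec_mulVec, dotProduct_mulVec (y t) Fᵀ,
      vecMul_transpose, add_comm]
  rw [e]
  simp only [dotProduct, ← Finset.sum_add_distrib]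

omit [DecidableEq ι] in
theorem tendsto_dotProduct_mulVec_zero (P : Matrix ι ι ℝ) {y z : ℝ → ι → ℝ}
    (hy : Tendsto y atTop (𝓝 0)) (hz : Tendsto z atTop (𝓝 0)) :
    Tendsto (fun t => y t ⬝ᵥ P *ᵥ z t) atTop (𝓝 0) := by
  have hc : Continuous fun w : (ι → ℝ) × (ι → ℝ) => w.1 ⬝ᵥ P *ᵥ w.2 := by fun_prop
  simpa using! (hc.tendsto (0, 0)).comp (hy.prodMk_nhds hz)

/-- Along two trajectories `y`, `z` the number `yᵀ P z` is constant, and it tends to zero; the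
initial values are arbitrary. -/
theorem lyapunov_injective {F : Matrix ι ι ℝ}
    (hF : ∀ s ∈ spectrum ℂ (F.map (algebraMap ℝ ℂ)), s.re < 0) {P : Matrix ι ι ℝ}
    (hP : P * F + Fᵀ * P = 0) : P = 0 := by
  have key : ∀ x w : ι → ℝ, x ⬝ᵥ P *ᵥ w = 0 := by
    intro x w
    obtain ⟨y, rfl, hy, hyt⟩ := exists_stable_trajectory hF x
    obtain ⟨z, rfl, hz, hzt⟩ := exists_stable_trajectory hF w
    have hd : ∀ t, HasDerivAt (fun t => y t ⬝ᵥ P *ᵥ z t) 0 t := fun t => by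
      simpa [hP] using hasDerivAt_dotProduct_mulVec P F (hy t) (hz t)
    have hc : ∀ t, y t ⬝ᵥ P *ᵥ z t = y 0 ⬝ᵥ P *ᵥ z 0 := fun t =>
      is_const_of_deriv_eq_zero (fun t => (hd t).differentiableAt) (fun t => (hd t).deriv) t 0
    have h := tendsto_dotProduct_mulVec_zero P hyt hzt
    simp only [hc] at h
    exact tendsto_nhds_unique tendsto_const_nhds h
  ext i j
  simpa using key (Pi.single i 1) (Pi.single j 1)

/-- The Lyapunov equation with a Hurwitz matrix and a positive semidefinite right-hand side has
a positive semidefinite solution. -/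
theorem exists_posSemidef_lyapunov {F : Matrix ι ι ℝ}
    (hF : ∀ s ∈ spectrum ℂ (F.map (algebraMap ℝ ℂ)), s.re < 0) {Q : Matrix ι ι ℝ}
    (hQ : Q.PosSemidef) : ∃ P : Matrix ι ι ℝ, P.PosSemidef ∧ P * F + Fᵀ * P = -Q := by
  let Φ : Matrix ι ι ℝ →ₗ[ℝ] Matrix ι ι ℝ :=
    LinearMap.mulRight ℝ F + LinearMap.mulLeft ℝ Fᵀ
  have hΦ : ∀ P, Φ P = P * F + Fᵀ * P := fun P => rfl
  have hinj : Function.Injective Φ := by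
    rw [← LinearMap.ker_eq_bot, LinearMap.ker_eq_bot']
    exact fun P hP => lyapunov_injective hF hP
  obtain ⟨P, hP⟩ := LinearMap.injective_iff_surjective.1 hinj (-Q)
  rw [hΦ] at hP
  have hQt : Qᵀ = Q := by simpa using hQ.isHermitian.eq
  -- The transpose solves the same equation, so injectivity makes the solution symmetric.
  have hPt : Pᵀ = P := by
    apply hinj
    rw [hΦ, hΦ, hP]
    have := congrArg transpose hP
    rw [transpose_neg, hQt, transpose_add, transpose_mul, transpose_mul, transpose_transpose,
      add_comm] at this
    exact this
  refine ⟨P, PosSemidef.of_dotProduct_mulVec_nonneg (by simpa [IsHermitian] using hPt)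
    fun x => ?_, hP⟩
  obtain ⟨y, rfl, hy, hyt⟩ := exists_stable_trajectory hF x
  have hd : ∀ t, HasDerivAt (fun t => y t ⬝ᵥ P *ᵥ y t) (-(y t ⬝ᵥ Q *ᵥ y t)) t := fun t => by
    simpa [hP, neg_mulVec] using hasDerivAt_dotProduct_mulVec P F (hy t) (hy t)
  -- A nonincreasing function with limit zero is nonnegative at time `0`.
  have ha : Antitone fun t => y t ⬝ᵥ P *ᵥ y t := by
    refine antitone_of_deriv_nonpos (fun t => (hd t).differentiableAt) fun t => ?_
    rw [(hd t).deriv]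
    have := hQ.dotProduct_mulVec_nonneg (y t)
    simp only [star_trivial] at this
    linarith
  have := ha.le_of_tendsto (tendsto_dotProduct_mulVec_zero P hyt hyt) 0
  simpa using this

omit [DecidableEq ι] in
/-- A positive semidefinite real matrix with trivial kernel is positive definite. -/
theorem posDef_of_posSemidef_of_ker {P : Matrix ι ι ℝ} (hP : P.PosSemidef)
    (hk : ∀ x, P *ᵥ x = 0 → x = 0) : P.PosDef := by
  refine PosDef.of_dotProduct_mulVec_pos hP.isHermitian fun x hx => ?_
  refine lt_of_le_of_ne (hP.dotProduct_mulVec_nonneg x) fun h => hx (hk x ?_)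
  exact (hP.dotProduct_mulVec_zero_iff x).1 h.symm

theorem exists_posDef_lyapunov {F : Matrix ι ι ℝ}
    (hF : ∀ s ∈ spectrum ℂ (F.map (algebraMap ℝ ℂ)), s.re < 0) {Q : Matrix ι ι ℝ}
    (hQ : Q.PosDef) : ∃ P : Matrix ι ι ℝ, P.PosDef ∧ P * F + Fᵀ * P = -Q := by
  obtain ⟨P, hP, h⟩ := exists_posSemidef_lyapunov hF hQ.posSemidef
  refine ⟨P, posDef_of_posSemidef_of_ker hP fun x hx => ?_, h⟩
  by_contra hx0
  have h1 := hQ.dotProduct_mulVec_pos hx0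
  have h2 : x ⬝ᵥ Q *ᵥ x = 0 := by
    have hPt : Pᵀ = P := by simpa using hP.isHermitian.eq
    have hv : x ᵥ* P = 0 := by rw [← hx, ← mulVec_transpose, hPt]
    rw [← neg_neg Q, ← h, neg_mulVec, dotProduct_neg, add_mulVec, dotProduct_add,
      ← mulVec_mulVec, ← mulVec_mulVec, hx, mulVec_zero, dotProduct_zero, dotProduct_mulVec, hv,
      zero_dotProduct, add_zero, neg_zero]
  simp [h2] at h1

end Lyapunov
-- The Laplacian of a strongly connected graph.
section Graph
variable {N : ℕ} {G : WeightedDigraph N} {r : Fin N → ℝ}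

namespace WeightedDigraph

theorem vecMul_laplacian_eq_zero_iff :
    r ᵥ* G.laplacian = 0 ↔ ∀ j, r j * ∑ k, G.weight j k = ∑ i, r i * G.weight i j := by
  rw [funext_iff]
  refine forall_congr' fun j => ?_
  rw [laplacian, vecMul_sub, Pi.sub_apply, vecMul_diagonal, Pi.zero_apply, sub_eq_zero]
  rfl

/-- The triangle inequality gives `≤` in every column, and both sides have the same total over all
columns, so equality holds in each. -/
theorem abs_vecMul_laplacian (h : r ᵥ* G.laplacian = 0) :
    (fun i => |r i|) ᵥ* G.laplacian = 0 := by
  rw [vecMul_laplacian_eq_zero_iff] at h ⊢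
  have hle : ∀ j ∈ Finset.univ,
      |r j| * ∑ k, G.weight j k ≤ ∑ i, |r i| * G.weight i j := fun j _ => by
    have h0 : 0 ≤ ∑ k, G.weight j k := Finset.sum_nonneg fun k _ => G.weight_nonneg j k
    rw [← abs_of_nonneg h0, ← abs_mul, h j]
    refine (Finset.abs_sum_le_sum_abs _ _).trans (le_of_eq ?_)
    exact Finset.sum_congr rfl fun i _ => by rw [abs_mul, abs_of_nonneg (G.weight_nonneg i j)]
  have hsum : ∑ j, |r j| * ∑ k, G.weight j k = ∑ j, ∑ i, |r i| * G.weight i j := by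
    rw [Finset.sum_comm]
    simp only [Finset.mul_sum]
  exact fun j => (Finset.sum_eq_sum_iff_of_le hle).1 hsum j (Finset.mem_univ j)

/-- On a strongly connected graph a nonnegative left null vector of the Laplacian with a zero
entry vanishes. -/
theorem eq_zero_of_vecMul_laplacian (hG : G.IsStronglyConnected) (h : r ᵥ* G.laplacian = 0)
    (h0 : ∀ i, 0 ≤ r i) {j : Fin N} (hj : r j = 0) : r = 0 := by
  rw [vecMul_laplacian_eq_zero_iff] at h
  have step : ∀ a b, G.IsEdge a b → r a = 0 → r b = 0 := by
    intro a b hab ha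
    have h1 := h a
    rw [ha, zero_mul, eq_comm,
      Finset.sum_eq_zero_iff_of_nonneg fun i _ => mul_nonneg (h0 i) (G.weight_nonneg i a)] at h1
    exact (mul_eq_zero.1 (h1 b (Finset.mem_univ b))).resolve_right hab
  funext i
  by_cases hij : j = i
  · rw [← hij, hj]; rfl
  · have := hG j i hij
    induction this with
    | single hb => exact step _ _ hb hj
    | tail _ hb ih =>
      rename_i b c _
      by_cases hjb : j = b
      · exact step _ _ hb (hjb ▸ hj)
      · exact step _ _ hb (ih hjb)

theorem pos_of_vecMul_laplacian (hG : G.IsStronglyConnected) (h : r ᵥ* G.laplacian = 0)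
    (h0 : ∀ i, 0 ≤ r i) (hr : r ≠ 0) (i : Fin N) : 0 < r i :=
  lt_of_le_of_ne (h0 i) fun hi => hr (eq_zero_of_vecMul_laplacian hG h h0 hi.symm)

/-- If `r ≠ 0`, the nonnegative left null vector `r + |r|` either vanishes, which forces `∑ |r i| =
0`, or is positive everywhere, which forces `r > 0`. Both contradict the zero sum. Uniqueness of the
normalized vector follows by taking differences. -/
theorem eq_zero_of_vecMul_laplacian_of_sum (hG : G.IsStronglyConnected)
    (h : r ᵥ* G.laplacian = 0) (hs : ∑ i, r i = 0) : r = 0 := by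
  by_contra hr
  have hne : (Finset.univ : Finset (Fin N)).Nonempty := by
    obtain ⟨i, -⟩ := Function.ne_iff.1 hr
    exact ⟨i, Finset.mem_univ i⟩
  have ha := abs_vecMul_laplacian h
  have hra : ∀ i, 0 < |r i| := pos_of_vecMul_laplacian hG ha (fun i => abs_nonneg _) fun h1 =>
    hr (funext fun i => abs_eq_zero.1 (congrFun h1 i))
  have hp : (r + fun i => |r i|) ᵥ* G.laplacian = 0 := by rw [add_vecMul, h, ha, add_zero]
  have hp0 : ∀ i, 0 ≤ (r + fun i => |r i|) i := fun i => by
    simpa using neg_le_iff_add_nonneg'.1 (neg_abs_le (r i)) |>.trans_eq (add_comm _ _)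
  have key : ∑ i, (r + fun i => |r i|) i = ∑ i, |r i| := by
    simp [Finset.sum_add_distrib, hs]
  by_cases hz : (r + fun i => |r i|) = 0
  · have := Finset.sum_pos (fun i _ => hra i) hne
    rw [← key, hz] at this
    simp at this
  · have h1 := pos_of_vecMul_laplacian hG hp hp0 hz
    have hpos : ∀ i, 0 < r i := fun i => by
      by_contra hi
      have := h1 i
      simp [abs_of_nonpos (not_lt.1 hi)] at this
    have := Finset.sum_pos (fun i _ => hpos i) hne
    linarith

theorem laplacian_mulVec_one : G.laplacian *ᵥ (fun _ => 1) = 0 := by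
  ext i
  rw [laplacian, sub_mulVec, Pi.sub_apply, mulVec_diagonal, mul_one, mulVec, dotProduct]
  simp

theorem existsUnique_isNormalizedLeftNull (hN : 0 < N) (hG : G.IsStronglyConnected) :
    ∃! r : Fin N → ℝ, G.IsNormalizedLeftNull r := by
  have hdet : G.laplacian.det = 0 := exists_mulVec_eq_zero_iff.1
    ⟨fun _ => 1, Function.ne_iff.2 ⟨⟨0, hN⟩, one_ne_zero⟩, laplacian_mulVec_one⟩
  obtain ⟨w, hw0, hw⟩ := exists_vecMul_eq_zero_iff.2 hdet
  have hp : ∀ i, 0 < |w i| := pos_of_vecMul_laplacian hG (abs_vecMul_laplacian hw)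
    (fun i => abs_nonneg _) fun h1 => hw0 (funext fun i => abs_eq_zero.1 (congrFun h1 i))
  have hN' : (0 : ℝ) < N := by exact_mod_cast hN
  have hS : 0 < ∑ i, |w i| := Finset.sum_pos (fun i _ => hp i) ⟨⟨0, hN⟩, Finset.mem_univ _⟩
  refine ⟨((N : ℝ) / ∑ i, |w i|) • fun i => |w i|, ⟨fun i => ?_, ?_, ?_⟩, ?_⟩
  · exact mul_pos (div_pos hN' hS) (hp i)
  · rw [smul_vecMul, abs_vecMul_laplacian hw, smul_zero]
  · simp only [Pi.smul_apply, smul_eq_mul, ← Finset.mul_sum]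
    exact div_mul_cancel₀ _ hS.ne'
  · rintro s ⟨hs, hsn, hss⟩
    rw [← sub_eq_zero]
    refine eq_zero_of_vecMul_laplacian_of_sum hG ?_ ?_
    · rw [sub_vecMul, hsn, smul_vecMul, abs_vecMul_laplacian hw, smul_zero, sub_zero]
    · simp only [Pi.sub_apply, Finset.sum_sub_distrib, hss, Pi.smul_apply, smul_eq_mul,
        ← Finset.mul_sum]
      rw [div_mul_cancel₀ _ hS.ne', sub_self]

/-- Left nullity says that the weights `r i * G.weight i j` are balanced, with equal row and column
sums; hence `x j ^ 2` and `x i ^ 2` have the same weighted total. -/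
theorem diagonal_mul_laplacian_dotProduct (h : r ᵥ* G.laplacian = 0) (x : Fin N → ℝ) :
    2 * (x ⬝ᵥ (diagonal r * G.laplacian) *ᵥ x)
      = ∑ i, ∑ j, r i * G.weight i j * (x i - x j) ^ 2 := by
  rw [vecMul_laplacian_eq_zero_iff] at h
  have h1 : x ⬝ᵥ (diagonal r * G.laplacian) *ᵥ x
      = ∑ i, ∑ j, (r i * G.weight i j * x i ^ 2 - r i * G.weight i j * (x i * x j)) := by
    rw [← mulVec_mulVec, laplacian, sub_mulVec, dotProduct]
    refine Finset.sum_congr rfl fun i _ => ?_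
    rw [mulVec_diagonal, Pi.sub_apply, mulVec_diagonal, Finset.sum_sub_distrib, mulVec,
      dotProduct, mul_sub, mul_sub, Finset.sum_mul]
    simp only [Finset.mul_sum]
    congr 1 <;> exact Finset.sum_congr rfl fun j _ => by ring
  have h2 : ∑ i, ∑ j, r i * G.weight i j * x j ^ 2 = ∑ i, ∑ j, r i * G.weight i j * x i ^ 2 := by
    rw [Finset.sum_comm]
    refine Finset.sum_congr rfl fun j _ => ?_
    rw [← Finset.sum_mul, ← h j, Finset.mul_sum, Finset.sum_mul]
  have h3 : ∑ i, ∑ j, r i * G.weight i j * (x i - x j) ^ 2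
      = 2 * (∑ i, ∑ j, (r i * G.weight i j * x i ^ 2 - r i * G.weight i j * (x i * x j)))
        + (∑ i, ∑ j, r i * G.weight i j * x j ^ 2 - ∑ i, ∑ j, r i * G.weight i j * x i ^ 2) := by
    simp only [Finset.mul_sum, ← Finset.sum_add_distrib, ← Finset.sum_sub_distrib]
    exact Finset.sum_congr rfl fun i _ => Finset.sum_congr rfl fun j _ => by ring
  rw [h1, h3, h2, sub_self, add_zero]

theorem mirrorLaplacian_dotProduct (x : Fin N → ℝ) :
    x ⬝ᵥ G.mirrorLaplacian r *ᵥ x = 2 * (x ⬝ᵥ (diagonal r * G.laplacian) *ᵥ x) := by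
  have h : G.laplacianᵀ * diagonal r = (diagonal r * G.laplacian)ᵀ := by simp
  rw [mirrorLaplacian, h, add_mulVec, dotProduct_add, mulVec_transpose, dotProduct_comm x (x ᵥ* _),
    ← dotProduct_mulVec, two_mul]

theorem eq_of_sum_weight_mul_sq_eq_zero (hG : G.IsStronglyConnected) (hr : ∀ i, 0 < r i)
    {x : Fin N → ℝ} (hx : ∑ i, ∑ j, r i * G.weight i j * (x i - x j) ^ 2 = 0) (i j : Fin N) :
    x i = x j := by
  have hnn : ∀ i j, 0 ≤ r i * G.weight i j * (x i - x j) ^ 2 := fun i j =>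
    mul_nonneg (mul_nonneg (hr i).le (G.weight_nonneg i j)) (sq_nonneg _)
  have step : ∀ a b, G.IsEdge a b → x a = x b := by
    intro a b hab
    have h1 := (Finset.sum_eq_zero_iff_of_nonneg fun i _ =>
      Finset.sum_nonneg fun j _ => hnn i j).1 hx b (Finset.mem_univ b)
    have h2 := (Finset.sum_eq_zero_iff_of_nonneg fun j _ => hnn b j).1 h1 a (Finset.mem_univ a)
    have h3 := pow_eq_zero_iff two_ne_zero |>.1
      ((mul_eq_zero.1 h2).resolve_left (mul_ne_zero (hr b).ne' hab))
    linarith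
  by_cases hij : i = j
  · rw [hij]
  · have := hG i j hij
    clear hij
    induction this with
    | single hb => exact step _ _ hb
    | tail _ hb ih => exact ih.trans (step _ _ hb)

end WeightedDigraph
end Graph
-- Observable pairs and stabilizing output injection.
section Observability
variable {m : Type*} {n : ℕ}

/-- By Cayley–Hamilton every power of `A` is a combination of the first `n` ones. -/
theorem obsMatrix_mulVec_eq_zero_iff (C : Matrix m (Fin n) ℝ) (A : Matrix (Fin n) (Fin n) ℝ)
    (x : Fin n → ℝ) : obsMatrix C A *ᵥ x = 0 ↔ ∀ k, (C * A ^ k) *ᵥ x = 0 := by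
  have h1 : obsMatrix C A *ᵥ x = 0 ↔ ∀ k < n, (C * A ^ k) *ᵥ x = 0 := by
    constructor
    · intro h k hk
      ext i
      exact congrFun h (⟨k, hk⟩, i)
    · intro h
      ext ⟨k, i⟩
      exact congrFun (h k k.2) i
  rw [h1]
  refine ⟨fun h k => ?_, fun h k _ => h k⟩
  -- For `n = 0` the characteristic polynomial is `1` and the degree bound on the remainder fails.
  rcases Nat.eq_zero_or_pos n with rfl | hn
  · rw [Subsingleton.elim x 0, mulVec_zero]
  have hd : (Polynomial.X ^ k %ₘ A.charpoly).natDegree < n := by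
    have := Polynomial.natDegree_modByMonic_lt (Polynomial.X ^ k) A.charpoly_monic (fun h0 => by
      have h2 := A.charpoly_natDegree_eq_dim
      rw [h0, Polynomial.natDegree_one, Fintype.card_fin] at h2
      omega)
    rwa [A.charpoly_natDegree_eq_dim, Fintype.card_fin] at this
  rw [pow_eq_aeval_mod_charpoly, Polynomial.aeval_eq_sum_range' hd, Matrix.mul_sum, sum_mulVec]
  refine Finset.sum_eq_zero fun j hj => ?_
  rw [Matrix.mul_smul, smul_mulVec, h j (Finset.mem_range.1 hj), smul_zero]

theorem isObservable_iff (C : Matrix m (Fin n) ℝ) (A : Matrix (Fin n) (Fin n) ℝ) :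
    IsObservable C A ↔ ∀ x, (∀ k, (C * A ^ k) *ᵥ x = 0) → x = 0 := by
  simp only [IsObservable, LinearMap.ker_eq_bot', mulVecLin_apply, obsMatrix_mulVec_eq_zero_iff]

theorem exists_mulVec_eq_smul_of_mem_spectrum {ι K : Type*} [Fintype ι] [DecidableEq ι] [Field K]
    {M : Matrix ι ι K} {s : K} (hs : s ∈ spectrum K M) : ∃ v, v ≠ 0 ∧ M *ᵥ v = s • v := by
  rw [← Matrix.spectrum_toLin', ← Module.End.hasEigenvalue_iff_mem_spectrum] at hs
  obtain ⟨v, hv⟩ := hs.exists_hasEigenvector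
  exact ⟨v, hv.2, by simpa using hv.apply_eq_smul⟩

theorem mem_spectrum_of_mulVec_eq_smul {ι K : Type*} [Fintype ι] [DecidableEq ι] [Field K]
    {M : Matrix ι ι K} {s : K} {v : ι → K} (hv : v ≠ 0) (h : M *ᵥ v = s • v) :
    s ∈ spectrum K M := by
  rw [← Matrix.spectrum_toLin', ← Module.End.hasEigenvalue_iff_mem_spectrum]
  exact Module.End.hasEigenvalue_of_hasEigenvector
    ⟨Module.End.mem_eigenspace_iff.2 (by simpa using h), hv⟩

/-- If `P > 0` and `P B + Bᵀ P = -2 β P` then all eigenvalues of `B` have real part `-β`. -/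
theorem re_eq_of_posDef_lyapunov {ι : Type*} [Fintype ι] [DecidableEq ι] {P B : Matrix ι ι ℝ}
    {β : ℝ} (hP : P.PosDef) (h : P * B + Bᵀ * P = -(2 * β) • P) {s : ℂ}
    (hs : s ∈ spectrum ℂ (B.map (algebraMap ℝ ℂ))) : s.re = -β := by
  obtain ⟨v, hv, hBv⟩ := exists_mulVec_eq_smul_of_mem_spectrum hs
  set u : ι → ℝ := fun i => (v i).re with hu
  set w : ι → ℝ := fun i => (v i).im with hw
  have hBu : B *ᵥ u = s.re • u - s.im • w := by
    ext i
    have := congrArg Complex.re (congrFun hBv i)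
    simpa [mulVec, dotProduct, hu, hw] using this
  have hBw : B *ᵥ w = s.im • u + s.re • w := by
    ext i
    have := congrArg Complex.im (congrFun hBv i)
    simpa [mulVec, dotProduct, hu, hw, add_comm] using this
  have hPt : Pᵀ = P := by simpa using hP.isHermitian.eq
  have hsym : ∀ x y : ι → ℝ, x ⬝ᵥ P *ᵥ y = y ⬝ᵥ P *ᵥ x := fun x y => by
    rw [dotProduct_mulVec, ← mulVec_transpose, hPt, dotProduct_comm]
  have hq : ∀ x : ι → ℝ, 2 * (x ⬝ᵥ P *ᵥ (B *ᵥ x)) = -(2 * β) * (x ⬝ᵥ P *ᵥ x) := fun x => by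
    have h1 := congrArg (fun M => x ⬝ᵥ M *ᵥ x) h
    simp only [add_mulVec, smul_mulVec, dotProduct_add, dotProduct_smul, smul_eq_mul,
      ← mulVec_mulVec] at h1
    rw [dotProduct_mulVec x Bᵀ, vecMul_transpose, hsym (B *ᵥ x)] at h1
    linarith
  -- Adding the identities for the real and imaginary parts of the eigenvector cancels the cross
  -- terms in `s.im`.
  have hqu := hq u
  have hqw := hq w
  simp only [hBu, hBw, mulVec_sub, mulVec_add, mulVec_smul, dotProduct_sub, dotProduct_add,
    dotProduct_smul, smul_eq_mul, hsym w u] at hqu hqw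
  have hpos : 0 < u ⬝ᵥ P *ᵥ u + w ⬝ᵥ P *ᵥ w := by
    have h0 : ∀ x : ι → ℝ, 0 ≤ x ⬝ᵥ P *ᵥ x := fun x => by
      simpa using hP.posSemidef.dotProduct_mulVec_nonneg x
    have h1 : ∀ x : ι → ℝ, x ≠ 0 → 0 < x ⬝ᵥ P *ᵥ x := fun x hx => by
      simpa using hP.dotProduct_mulVec_pos hx
    by_cases hu0 : u = 0
    · by_cases hw0 : w = 0
      · exact absurd (funext fun i => Complex.ext (congrFun hu0 i) (congrFun hw0 i)) hv
      · exact add_pos_of_nonneg_of_pos (h0 u) (h1 w hw0)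
    · exact add_pos_of_pos_of_nonneg (h1 u hu0) (h0 w)
  have : (s.re + β) * (u ⬝ᵥ P *ᵥ u + w ⬝ᵥ P *ᵥ w) = 0 := by linarith
  linarith [(mul_eq_zero.1 this).resolve_right hpos.ne']

/-- An observable pair admits an output injection with arbitrarily fast error dynamics. -/
theorem exists_stabilizing_injection [Fintype m] {C : Matrix m (Fin n) ℝ}
    {A : Matrix (Fin n) (Fin n) ℝ} (hobs : IsObservable C A) (α : ℝ) :
    ∃ L : Matrix (Fin n) m ℝ, ∀ s ∈ spectrum ℂ ((A - L * C).map (algebraMap ℝ ℂ)), s.re < -α := by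
  obtain ⟨b, hb⟩ := ((Matrix.finite_spectrum (A.map (algebraMap ℝ ℂ))).image
    fun s : ℂ => -s.re).bddAbove
  -- The bound `β > b` makes `-(A + β I)` Hurwitz, and `β > α` gives the required rate: every
  -- eigenvalue of `A - L C` will have real part exactly `-β`.
  set β := max b α + 1
  have hbβ : b < β := by have := le_max_left b α; linarith
  have hαβ : α < β := by have := le_max_right b α; linarith
  clear_value β
  have hF : ∀ s ∈ spectrum ℂ ((-(A + β • (1 : Matrix (Fin n) (Fin n) ℝ))).map (algebraMap ℝ ℂ)),
      s.re < 0 := by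
    intro s hs
    obtain ⟨v, hv, hs⟩ := exists_mulVec_eq_smul_of_mem_spectrum hs
    have hm : (-(A + β • (1 : Matrix (Fin n) (Fin n) ℝ))).map (algebraMap ℝ ℂ)
        = -(A.map (algebraMap ℝ ℂ) + (β : ℂ) • (1 : Matrix (Fin n) (Fin n) ℂ)) := by
      ext i j
      by_cases hij : i = j <;> simp [hij]
    rw [hm, neg_mulVec, add_mulVec, smul_mulVec, one_mulVec] at hs
    have h1 : A.map (algebraMap ℝ ℂ) *ᵥ v = (-s - β) • v := by
      rw [sub_smul, neg_smul, ← hs]; abel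
    have h2 := hb ⟨_, mem_spectrum_of_mulVec_eq_smul hv h1, rfl⟩
    simp at h2
    linarith
  have hCC : (Cᵀ * C).PosSemidef := by
    simpa using posSemidef_conjTranspose_mul_self C
  -- The term `CᵀC` is taken twice because `L = P⁻¹Cᵀ` removes it once from `P A` and once from `Aᵀ
  -- P`, which leaves `-2βP`.
  obtain ⟨P, hP, hPF⟩ := exists_posSemidef_lyapunov hF (hCC.add hCC)
  have hPt : Pᵀ = P := by simpa using hP.isHermitian.eq
  have hLy : P * A + Aᵀ * P = Cᵀ * C + Cᵀ * C - (2 * β) • P := by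
    rw [transpose_neg, transpose_add, transpose_smul, transpose_one, mul_neg, neg_mul, mul_add,
      add_mul, Matrix.mul_smul, Matrix.smul_mul, mul_one, one_mul, ← neg_add, neg_inj] at hPF
    rw [← hPF, two_mul, add_smul]; abel
  -- The kernel of `P` is `A`-invariant and lies in the kernel of `C`, so observability makes it
  -- trivial.
  have hstep : ∀ x, P *ᵥ x = 0 → C *ᵥ x = 0 ∧ P *ᵥ (A *ᵥ x) = 0 := by
    intro x hx
    have h1 := congrArg (fun M => M *ᵥ x) hLy
    simp only [add_mulVec, sub_mulVec, smul_mulVec, ← mulVec_mulVec, hx, mulVec_zero, smul_zero,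
      add_zero, sub_zero] at h1
    have hC : C *ᵥ x = 0 := by
      have h2 := congrArg (fun y => x ⬝ᵥ y) h1
      simp only [dotProduct_add] at h2
      rw [dotProduct_mulVec x P, ← mulVec_transpose, hPt, hx, zero_dotProduct,
        dotProduct_mulVec x Cᵀ, vecMul_transpose] at h2
      exact dotProduct_self_eq_zero.1 (by linarith)
    refine ⟨hC, ?_⟩
    rw [h1, hC, mulVec_zero, add_zero]
  have hPd : P.PosDef := by
    refine posDef_of_posSemidef_of_ker hP fun x hx => (isObservable_iff C A).1 hobs x fun k => ?_
    have : P *ᵥ (A ^ k *ᵥ x) = 0 := by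
      induction k with
      | zero => simpa using hx
      | succ k ih => rw [pow_succ', ← mulVec_mulVec]; exact (hstep _ ih).2
    rw [← mulVec_mulVec]
    exact (hstep _ this).1
  have hu : P * P⁻¹ = 1 := mul_nonsing_inv P ((isUnit_iff_isUnit_det P).1 hPd.isUnit)
  have hu' : P⁻¹ * P = 1 := nonsing_inv_mul P ((isUnit_iff_isUnit_det P).1 hPd.isUnit)
  refine ⟨P⁻¹ * Cᵀ, fun s hs => ?_⟩
  have : s.re = -β := by
    refine re_eq_of_posDef_lyapunov hPd ?_ hs
    have e1 : P * (P⁻¹ * Cᵀ * C) = Cᵀ * C := by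
      rw [Matrix.mul_assoc, ← Matrix.mul_assoc P, hu, one_mul]
    have e2 : (P⁻¹ * Cᵀ * C)ᵀ * P = Cᵀ * C := by
      rw [transpose_mul, transpose_mul, transpose_transpose, transpose_nonsing_inv, hPt,
        Matrix.mul_assoc, Matrix.mul_assoc, hu', Matrix.mul_one]
    rw [transpose_sub, mul_sub, sub_mul, e1, e2, neg_smul]
    rw [eq_neg_iff_add_eq_zero]
    rw [eq_sub_iff_add_eq] at hLy
    rw [← sub_eq_zero.2 hLy]
    abel
  linarith

end Observability

/-! ### Orthogonal observability decompositions. -/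

section Decomposition
variable {p n : ℕ} {H : Matrix (Fin p) (Fin n) ℝ} {A : Matrix (Fin n) (Fin n) ℝ}

/-- The zero blocks let the first coordinates evolve on their own, and the output sees only these.
-/
theorem mul_pow_mulVec_of_block {v w : ℕ} {T : Matrix (Fin n) (Fin v ⊕ Fin w) ℝ}
    (hT : T * Tᵀ = 1) (hA : (Tᵀ * A * T).toBlocks₁₂ = 0) (hH : (H * T).toCols₂ = 0) (k : ℕ)
    (z : Fin v ⊕ Fin w → ℝ) :
    (H * A ^ k) *ᵥ (T *ᵥ z)
      = ((H * T).toCols₁ * (Tᵀ * A * T).toBlocks₁₁ ^ k) *ᵥ (z ∘ Sum.inl) := by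
  induction k generalizing z with
  | zero =>
    rw [pow_zero, pow_zero, Matrix.mul_one, Matrix.mul_one, mulVec_mulVec, ← fromCols_toCols (H * T), hH,
      fromCols_mulVec]
    simp
  | succ k ih =>
    have h1 : A *ᵥ (T *ᵥ z) = T *ᵥ ((Tᵀ * A * T) *ᵥ z) := by
      rw [mulVec_mulVec, mulVec_mulVec, ← Matrix.mul_assoc, ← Matrix.mul_assoc, hT, one_mul]
    have h2 : ((Tᵀ * A * T) *ᵥ z) ∘ Sum.inl = (Tᵀ * A * T).toBlocks₁₁ *ᵥ (z ∘ Sum.inl) := by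
      conv_lhs => rw [← fromBlocks_toBlocks (Tᵀ * A * T), hA, fromBlocks_mulVec]
      simp
    rw [pow_succ, ← Matrix.mul_assoc, ← mulVec_mulVec, h1, ih, h2, mulVec_mulVec, pow_succ,
      Matrix.mul_assoc]

/-- The columns of `T` are an orthonormal basis of `Wᗮ` followed by one of `W`, where `W` is the
unobservable subspace. Invariance of `W` under `A` gives the zero block of `Tᵀ A T`. -/
theorem nonempty_obsDecomp (H : Matrix (Fin p) (Fin n) ℝ) (A : Matrix (Fin n) (Fin n) ℝ) :
    Nonempty (ObsDecomp H A) := by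
  let W : Submodule ℝ (EuclideanSpace ℝ (Fin n)) :=
    (LinearMap.ker (obsMatrix H A).mulVecLin).comap
      (WithLp.linearEquiv 2 ℝ (Fin n → ℝ)).toLinearMap
  have hW : ∀ x, x ∈ W ↔ ∀ k, (H * A ^ k) *ᵥ x.ofLp = 0 := fun x => by
    rw [← obsMatrix_mulVec_eq_zero_iff]; rfl
  have hdim : Module.finrank ℝ W + Module.finrank ℝ Wᗮ = n := by
    rw [W.finrank_add_finrank_orthogonal, finrank_euclideanSpace_fin]
  let b₁ := stdOrthonormalBasis ℝ Wᗮ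
  let b₂ := (stdOrthonormalBasis ℝ W).reindex
    (finCongr (show Module.finrank ℝ W = n - Module.finrank ℝ Wᗮ by omega))
  let c : Fin (Module.finrank ℝ Wᗮ) ⊕ Fin (n - Module.finrank ℝ Wᗮ) → EuclideanSpace ℝ (Fin n) :=
    Sum.elim (fun a => (b₁ a : EuclideanSpace ℝ (Fin n))) fun a => b₂ a
  let T : Matrix (Fin n) (Fin (Module.finrank ℝ Wᗮ) ⊕ Fin (n - Module.finrank ℝ Wᗮ)) ℝ :=
    Matrix.of fun i a => c a i
  have hinner : ∀ a (x : Fin n → ℝ), (Tᵀ *ᵥ x) a = inner ℝ (c a) (WithLp.toLp 2 x) := fun a x => by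
    simp [T, mulVec, dotProduct, PiLp.inner_apply, mul_comm]
  have hcol : ∀ a, T *ᵥ Pi.single a 1 = (c a).ofLp := fun a => by ext; simp [T]
  have hTT : Tᵀ * T = 1 := by
    ext a b
    have : (Tᵀ * T) a b = (Tᵀ *ᵥ (T *ᵥ Pi.single b 1)) a := by rw [mulVec_mulVec]; simp
    rw [this, hcol, hinner]
    rcases a with a | a <;> rcases b with b | b
    · simpa [c, Matrix.one_apply] using orthonormal_iff_ite.1 b₁.orthonormal a b
    · simpa [c] using Submodule.inner_left_of_mem_orthogonal (b₂ b).2 (b₁ a).2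
    · simpa [c] using Submodule.inner_right_of_mem_orthogonal (b₂ a).2 (b₁ b).2
    · simpa [c, Matrix.one_apply] using orthonormal_iff_ite.1 b₂.orthonormal a b
  have hT : T * Tᵀ = 1 := by
    refine (mul_eq_one_comm_of_card_eq _ _ _ ?_).1 hTT
    simp only [Fintype.card_sum, Fintype.card_fin]; omega
  have hA : (Tᵀ * A * T).toBlocks₁₂ = 0 := by
    ext a b
    have : (Tᵀ * A * T).toBlocks₁₂ a b
        = (Tᵀ *ᵥ (A *ᵥ (T *ᵥ Pi.single (Sum.inr b) 1))) (Sum.inl a) := by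
      rw [mulVec_mulVec, mulVec_mulVec]; simp [toBlocks₁₂]
    rw [this, hcol, hinner]
    refine Submodule.inner_left_of_mem_orthogonal ((hW _).2 fun k => ?_) (b₁ a).2
    have := (hW _).1 (b₂ b).2 (k + 1)
    rw [pow_succ, ← Matrix.mul_assoc, ← mulVec_mulVec] at this
    exact this
  have hH : (H * T).toCols₂ = 0 := by
    ext a b
    have : (H * T).toCols₂ a b = (H *ᵥ (T *ᵥ Pi.single (Sum.inr b) 1)) a := by
      rw [mulVec_mulVec]; simp [toCols₂]
    rw [this, hcol]
    have := (hW _).1 (b₂ b).2 0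
    rw [pow_zero, Matrix.mul_one] at this
    exact congrFun this a
  refine ⟨⟨Module.finrank ℝ Wᗮ, by omega, T, hT, hA, hH, (isObservable_iff _ _).2 fun x hx => ?_⟩⟩
  -- A vector invisible to `(H_o, A_o)` lifts into `W`, so its coordinates along `Wᗮ`, which are the
  -- entries of `x`, vanish.
  have hmem : WithLp.toLp 2 (T *ᵥ Sum.elim x 0) ∈ W := (hW _).2 fun k => by
    have := mul_pow_mulVec_of_block hT hA hH k (Sum.elim x 0)
    rw [Sum.elim_comp_inl, hx k] at this
    exact this
  ext a
  have h1 : (Tᵀ *ᵥ (T *ᵥ Sum.elim x 0)) (Sum.inl a) = x a := by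
    rw [mulVec_mulVec, hTT, one_mulVec]; rfl
  rw [← h1, hinner]
  exact Submodule.inner_left_of_mem_orthogonal hmem (b₁ a).2

namespace ObsDecomp

theorem transpose_mul_self (D : ObsDecomp H A) : D.Tᵀ * D.T = 1 := by
  refine (mul_eq_one_comm_of_card_eq _ _ _ ?_).1 D.orthogonal
  have := D.v_le
  simp only [Fintype.card_sum, Fintype.card_fin]; omega

theorem mul_pow_mulVec_eq_zero (D : ObsDecomp H A) {x : Fin n → ℝ}
    (hx : (D.Tᵀ *ᵥ x) ∘ Sum.inl = 0) (k : ℕ) : (H * A ^ k) *ᵥ x = 0 := by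
  have := mul_pow_mulVec_of_block D.orthogonal D.block_zero D.cols_zero k (D.Tᵀ *ᵥ x)
  rwa [mulVec_mulVec x D.T, D.orthogonal, one_mulVec, hx, mulVec_zero] at this

end ObsDecomp
end Decomposition
-- Bounds for quadratic forms and exponential decay.
section QuadraticForms
variable {ι : Type*} [Fintype ι]

theorem norm_toLp_sq (x : ι → ℝ) : ‖WithLp.toLp 2 x‖ ^ 2 = x ⬝ᵥ x := by
  rw [EuclideanSpace.real_norm_sq_eq]
  simp [dotProduct, sq]

theorem exists_dotProduct_mulVec_le (M : Matrix ι ι ℝ) :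
    ∃ C, 0 ≤ C ∧ ∀ x : ι → ℝ, x ⬝ᵥ M *ᵥ x ≤ C * (x ⬝ᵥ x) := by
  refine ⟨∑ i, ∑ j, |M i j|, Finset.sum_nonneg fun i _ => Finset.sum_nonneg fun j _ =>
    abs_nonneg _, fun x => ?_⟩
  have hsq : ∀ i, x i ^ 2 ≤ x ⬝ᵥ x := fun i => by
    have := Finset.single_le_sum (f := fun i => x i * x i) (fun i _ => mul_self_nonneg _)
      (Finset.mem_univ i)
    rw [sq]; exact this
  have h1 : x ⬝ᵥ M *ᵥ x = ∑ i, ∑ j, M i j * (x i * x j) := by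
    simp only [dotProduct, mulVec, Finset.mul_sum]
    exact Finset.sum_congr rfl fun i _ => Finset.sum_congr rfl fun j _ => by ring
  rw [h1]
  simp only [Finset.sum_mul]
  refine Finset.sum_le_sum fun i _ => Finset.sum_le_sum fun j _ => ?_
  refine (le_abs_self _).trans ?_
  rw [abs_mul]
  refine mul_le_mul_of_nonneg_left (abs_le.2 ⟨?_, ?_⟩) (abs_nonneg _)
  · nlinarith [sq_nonneg (x i + x j), hsq i, hsq j]
  · nlinarith [sq_nonneg (x i - x j), hsq i, hsq j]

theorem exists_pos_le_dotProduct_mulVec {M : Matrix ι ι ℝ} (hM : M.PosDef) :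
    ∃ c, 0 < c ∧ ∀ x : ι → ℝ, c * (x ⬝ᵥ x) ≤ x ⬝ᵥ M *ᵥ x := by
  have hc : Continuous fun x : EuclideanSpace ℝ ι => x.ofLp ⬝ᵥ M *ᵥ x.ofLp := by fun_prop
  obtain ⟨c, hc0, hc⟩ := (isCompact_sphere (0 : EuclideanSpace ℝ ι) 1).exists_forall_le'
    (a := 0) hc.continuousOn fun x hx => by
      have hx0 : x.ofLp ≠ 0 := fun h => by
        have : x = 0 := by ext i; exact congrFun h i
        simp [this] at hx
      simpa using hM.dotProduct_mulVec_pos hx0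
  refine ⟨c, hc0, fun x => ?_⟩
  by_cases hx : x = 0
  · simp [hx]
  have hn : 0 < ‖WithLp.toLp 2 x‖ := by simpa using hx
  have h1 := hc (‖WithLp.toLp 2 x‖⁻¹ • WithLp.toLp 2 x) (by
    simp [norm_smul, inv_mul_cancel₀ hn.ne'])
  simp only [WithLp.ofLp_smul, mulVec_smul, smul_dotProduct, dotProduct_smul, smul_eq_mul] at h1
  rw [← norm_toLp_sq]
  have h2 := mul_le_mul_of_nonneg_right h1 (sq_nonneg ‖WithLp.toLp 2 x‖)
  refine h2.trans_eq ?_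
  field_simp

/-- The hypothesis bounds half the derivative of `eᵀ S e`, so `exp(2αt) eᵀ S e` is nonincreasing.
Comparing `S` with multiples `c` and `C` of the identity yields the constant `√(C / c)`. -/
theorem norm_le_of_lyapunov {S E : Matrix ι ι ℝ} (hS : S.PosDef) {α : ℝ}
    (h : ∀ x : ι → ℝ, x ⬝ᵥ S *ᵥ (E *ᵥ x) ≤ -α * (x ⬝ᵥ S *ᵥ x)) :
    ∃ C : ℝ, ∀ e : ℝ → ι → ℝ,
      (∀ t, 0 ≤ t → HasDerivWithinAt e (E *ᵥ e t) (Set.Ici 0) t) →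
      ∀ t, 0 ≤ t → ‖WithLp.toLp 2 (e t)‖ ≤ C * Real.exp (-α * t) * ‖WithLp.toLp 2 (e 0)‖ := by
  obtain ⟨c, hc, hcS⟩ := exists_pos_le_dotProduct_mulVec hS
  obtain ⟨C, hC, hCS⟩ := exists_dotProduct_mulVec_le S
  have hSt : Sᵀ = S := by simpa using hS.isHermitian.eq
  refine ⟨Real.sqrt (C / c), fun e he t ht => ?_⟩
  have hanti : AntitoneOn (fun t => Real.exp (2 * α * t) * (e t ⬝ᵥ S *ᵥ e t)) (Set.Ici 0) := by
    have hd : ∀ t, 0 < t → HasDerivAt (fun t => Real.exp (2 * α * t) * (e t ⬝ᵥ S *ᵥ e t))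
        (2 * α * Real.exp (2 * α * t) * (e t ⬝ᵥ S *ᵥ e t)
          + Real.exp (2 * α * t) * (e t ⬝ᵥ (S * E + Eᵀ * S) *ᵥ e t)) t := fun t ht => by
      have h1 := (he t ht.le).hasDerivAt (Ici_mem_nhds ht)
      have h2 : HasDerivAt (fun t => Real.exp (2 * α * t)) (2 * α * Real.exp (2 * α * t)) t := by
        refine (((hasDerivAt_id t).const_mul (2 * α)).exp).congr_deriv ?_
        rw [id_eq, mul_one, mul_comm]
      exact h2.mul (hasDerivAt_dotProduct_mulVec S E h1 h1)
    have hcont : ContinuousOn e (Set.Ici 0) := fun t ht => (he t ht).continuousWithinAt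
    -- At `0` only a one-sided derivative is given; continuity there suffices.
    refine antitoneOn_of_deriv_nonpos (convex_Ici 0) ?_ ?_ ?_
    · have hq : Continuous fun x : ι → ℝ => x ⬝ᵥ S *ᵥ x := by fun_prop
      exact ContinuousOn.mul (by fun_prop) (hq.comp_continuousOn hcont)
    · rw [interior_Ici]
      exact fun t ht => (hd t ht).differentiableAt.differentiableWithinAt
    · rw [interior_Ici]
      intro t ht
      rw [(hd t ht).deriv]
      have e1 : e t ⬝ᵥ (S * E + Eᵀ * S) *ᵥ e t = 2 * (e t ⬝ᵥ S *ᵥ (E *ᵥ e t)) := by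
        rw [add_mulVec, dotProduct_add, ← mulVec_mulVec, ← mulVec_mulVec, dotProduct_mulVec _ Eᵀ,
          vecMul_transpose, dotProduct_mulVec (E *ᵥ e t), ← mulVec_transpose, hSt,
          dotProduct_comm (S *ᵥ (E *ᵥ e t)), two_mul]
      have h3 := mul_le_mul_of_nonneg_left (h (e t)) (Real.exp_pos (2 * α * t)).le
      rw [e1]
      linarith
  have h1 := hanti (Set.mem_Ici.2 le_rfl) (Set.mem_Ici.2 ht) ht
  simp only [mul_zero, Real.exp_zero, one_mul] at h1
  have h2 : c * ‖WithLp.toLp 2 (e t)‖ ^ 2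
      ≤ Real.exp (-α * t) ^ 2 * (C * ‖WithLp.toLp 2 (e 0)‖ ^ 2) := by
    rw [norm_toLp_sq, norm_toLp_sq]
    refine (hcS (e t)).trans (le_trans ?_ (mul_le_mul_of_nonneg_left (hCS (e 0)) (sq_nonneg _)))
    have h3 := mul_le_mul_of_nonneg_left h1 (sq_nonneg (Real.exp (-α * t)))
    rw [← mul_assoc, ← Real.exp_nat_mul, ← Real.exp_add] at h3
    have h4 : ((2 : ℕ) : ℝ) * (-α * t) + 2 * α * t = 0 := by push_cast; ring
    rw [h4, Real.exp_zero, one_mul] at h3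
    rwa [← Real.exp_nat_mul]
  rw [← pow_le_pow_iff_left₀ (norm_nonneg _) (by positivity) two_ne_zero, mul_pow, mul_pow,
    Real.sq_sqrt (div_nonneg hC hc.le)]
  rw [← le_div_iff₀' hc] at h2
  refine h2.trans_eq ?_
  ring

end QuadraticForms

/-! ### The global error system and its blocks. -/

section BlockForms
variable {N n : ℕ}

theorem diagBlocks_mulVec (B : Fin N → Matrix (Fin n) (Fin n) ℝ) (w : Fin N × Fin n → ℝ)
    (i : Fin N) (k : Fin n) :
    (diagBlocks B *ᵥ w) (i, k) = (B i *ᵥ fun l => w (i, l)) k := by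
  simp [mulVec, dotProduct, diagBlocks, Fintype.sum_prod_type, ite_mul, Finset.sum_ite_irrel]

theorem diagBlocks_dotProduct (B : Fin N → Matrix (Fin n) (Fin n) ℝ) (w : Fin N × Fin n → ℝ) :
    w ⬝ᵥ diagBlocks B *ᵥ w = ∑ i, (fun l => w (i, l)) ⬝ᵥ B i *ᵥ fun l => w (i, l) := by
  rw [dotProduct, Fintype.sum_prod_type]
  simp only [diagBlocks_mulVec]
  rfl

theorem diagBlocks_mul (B B' : Fin N → Matrix (Fin n) (Fin n) ℝ) :
    diagBlocks B * diagBlocks B' = diagBlocks fun i => B i * B' i := by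
  ext ⟨i, k⟩ ⟨j, l⟩
  by_cases hij : i = j
  · subst hij
    simp [mul_apply, diagBlocks, Fintype.sum_prod_type, ite_mul, Finset.sum_ite_irrel]
  · simp [mul_apply, diagBlocks, Fintype.sum_prod_type, ite_mul, hij, Finset.sum_ite_irrel]

theorem kronecker_one_mulVec (Q : Matrix (Fin N) (Fin N) ℝ) (w : Fin N × Fin n → ℝ)
    (i : Fin N) (k : Fin n) :
    ((Q ⊗ₖ (1 : Matrix (Fin n) (Fin n) ℝ)) *ᵥ w) (i, k) = (Q *ᵥ fun j => w (j, k)) i := by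
  simp [mulVec, dotProduct, kroneckerMap_apply, Fintype.sum_prod_type, Matrix.one_apply]

theorem kronecker_one_dotProduct (Q : Matrix (Fin N) (Fin N) ℝ) (w : Fin N × Fin n → ℝ) :
    w ⬝ᵥ (Q ⊗ₖ (1 : Matrix (Fin n) (Fin n) ℝ)) *ᵥ w
      = ∑ k, (fun j => w (j, k)) ⬝ᵥ Q *ᵥ fun j => w (j, k) := by
  rw [dotProduct, Fintype.sum_prod_type_right]
  simp only [kronecker_one_mulVec]
  rfl

/-- Links the global matrix to the node equations: row `i` of `-R𝓛` produces `r i` times the sum of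
the weighted differences. -/
theorem errorMatrix_mulVec {p : Fin N → ℕ} (A : Matrix (Fin n) (Fin n) ℝ)
    (H : (i : Fin N) → Matrix (Fin (p i)) (Fin n) ℝ) (G : WeightedDigraph N)
    (r : Fin N → ℝ) (γ : ℝ) (L : (i : Fin N) → Matrix (Fin n) (Fin (p i)) ℝ)
    (M : Fin N → Matrix (Fin n) (Fin n) ℝ) (w : Fin N → Fin n → ℝ) (i : Fin N) (k : Fin n) :
    (errorMatrix A H G r γ L M *ᵥ fun jl => w jl.1 jl.2) (i, k)
      = (A *ᵥ w i - L i *ᵥ (H i *ᵥ w i)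
        + (γ * r i) • (M i *ᵥ ∑ j, G.weight i j • (w j - w i))) k := by
  have hL : ∀ l, ((diagonal r * G.laplacian) *ᵥ fun j => w j l) i
      = -(r i) * (∑ j, G.weight i j • (w j - w i)) l := fun l => by
    rw [← mulVec_mulVec, mulVec_diagonal, WeightedDigraph.laplacian, sub_mulVec, Pi.sub_apply,
      mulVec_diagonal, mulVec, dotProduct]
    simp only [Finset.sum_apply, Pi.smul_apply, Pi.sub_apply, smul_eq_mul, mul_sub,
      Finset.sum_sub_distrib, Finset.sum_mul]
    ring
  rw [errorMatrix, sub_mulVec, Pi.sub_apply, diagBlocks_mulVec, smul_mulVec, Pi.smul_apply,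
    ← mulVec_mulVec, diagBlocks_mulVec]
  simp only [kronecker_one_mulVec, hL]
  have : (fun l => -(r i) * (∑ j, G.weight i j • (w j - w i)) l)
      = -(r i) • ∑ j, G.weight i j • (w j - w i) := rfl
  rw [this, mulVec_smul, sub_mulVec, ← mulVec_mulVec]
  simp only [Pi.add_apply, Pi.sub_apply, Pi.smul_apply, smul_eq_mul]
  ring

theorem achievesOmniscience_of_errorsDecayAtRate {p : Fin N → ℕ} {A : Matrix (Fin n) (Fin n) ℝ}
    {H : (i : Fin N) → Matrix (Fin (p i)) (Fin n) ℝ} {G : WeightedDigraph N}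
    {r : Fin N → ℝ} {γ : ℝ} {L : (i : Fin N) → Matrix (Fin n) (Fin (p i)) ℝ}
    {M : Fin N → Matrix (Fin n) (Fin n) ℝ} {α : ℝ} (hα : 0 < α)
    (h : ErrorsDecayAtRate A H G r γ L M α) : AchievesOmniscience A H G r γ L M := by
  intro x xh hx hxh i
  obtain ⟨C, hC⟩ := h
  set e : ℝ → Fin N × Fin n → ℝ := fun t jl => xh jl.1 t jl.2 - x t jl.2 with he
  have hd : ∀ t, 0 ≤ t →
      HasDerivWithinAt e (errorMatrix A H G r γ L M *ᵥ e t) (Set.Ici 0) t := by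
    intro t ht
    rw [hasDerivWithinAt_pi]
    rintro ⟨j, l⟩
    refine ((hasDerivWithinAt_pi.1 (hxh j t ht) l).sub
      (hasDerivWithinAt_pi.1 (hx t ht) l)).congr_deriv ?_
    have := errorMatrix_mulVec A H G r γ L M (fun j => xh j t - x t) j l
    refine Eq.trans ?_ this.symm
    simp only [mulVec_sub, sub_sub_sub_cancel_right, Pi.add_apply, Pi.sub_apply]
    ring
  have hb := hC e hd
  have hlim : Filter.Tendsto (fun t => C * Real.exp (-α * t) * ‖WithLp.toLp 2 (e 0)‖)
      Filter.atTop (nhds 0) := by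
    have h1 : Filter.Tendsto (fun t => Real.exp (-α * t)) Filter.atTop (nhds 0) :=
      Real.tendsto_exp_atBot.comp
        (Filter.tendsto_id.const_mul_atTop_of_neg (neg_lt_zero.2 hα))
    simpa using (h1.const_mul C).mul_const ‖WithLp.toLp 2 (e 0)‖
  refine squeeze_zero' (Filter.Eventually.of_forall fun t => norm_nonneg _) ?_ hlim
  filter_upwards [Filter.eventually_ge_atTop 0] with t ht
  refine le_trans ?_ (hb t ht)
  rw [← pow_le_pow_iff_left₀ (norm_nonneg _) (norm_nonneg _) two_ne_zero, norm_toLp_sq,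
    norm_toLp_sq, dotProduct, dotProduct, Fintype.sum_prod_type]
  exact Finset.single_le_sum (f := fun j => ∑ l, e t (j, l) * e t (j, l))
    (fun j _ => Finset.sum_nonneg fun l _ => mul_self_nonneg _) (Finset.mem_univ i)

end BlockForms
theorem dotProduct_self_sum_elim {m n : Type*} [Fintype m] [Fintype n] (z : m ⊕ n → ℝ) :
    z ⬝ᵥ z = (z ∘ Sum.inl) ⬝ᵥ (z ∘ Sum.inl) + (z ∘ Sum.inr) ⬝ᵥ (z ∘ Sum.inr) := by
  simp [dotProduct]

theorem fromBlocks_dotProduct {m n : Type*} [Fintype m] [Fintype n] (A : Matrix m m ℝ)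
    (B : Matrix m n ℝ) (C : Matrix n m ℝ) (D : Matrix n n ℝ) (z : m ⊕ n → ℝ) :
    z ⬝ᵥ fromBlocks A B C D *ᵥ z
      = (z ∘ Sum.inl) ⬝ᵥ A *ᵥ (z ∘ Sum.inl) + (z ∘ Sum.inl) ⬝ᵥ B *ᵥ (z ∘ Sum.inr)
        + ((z ∘ Sum.inr) ⬝ᵥ C *ᵥ (z ∘ Sum.inl) + (z ∘ Sum.inr) ⬝ᵥ D *ᵥ (z ∘ Sum.inr)) := by
  rw [fromBlocks_mulVec, ← dotProduct_add, ← dotProduct_add]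
  simp [dotProduct]

/-! ### Feasibility of the design steps and the dissipation inequality. -/

section Design
variable {N n : ℕ} {p : Fin N → ℕ} {A : Matrix (Fin n) (Fin n) ℝ}
  {H : (i : Fin N) → Matrix (Fin (p i)) (Fin n) ℝ} {G : WeightedDigraph N} {r : Fin N → ℝ}
  {α ε γ : ℝ}

/-- The transformed coordinates `Tᵢᵀ wᵢ`. -/
def coords (D : (i : Fin N) → ObsDecomp (H i) A) (w : Fin N × Fin n → ℝ) (i : Fin N) :
    Fin (D i).v ⊕ Fin (n - (D i).v) → ℝ :=
  (D i).Tᵀ *ᵥ fun l => w (i, l)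

theorem T_mulVec_coords (D : (i : Fin N) → ObsDecomp (H i) A) (w : Fin N × Fin n → ℝ)
    (i : Fin N) : (D i).T *ᵥ coords D w i = fun l => w (i, l) := by
  rw [coords, mulVec_mulVec, (D i).orthogonal, one_mulVec]

theorem coords_eq_zero_iff (D : (i : Fin N) → ObsDecomp (H i) A) (w : Fin N × Fin n → ℝ) :
    (∀ i, coords D w i = 0) ↔ w = 0 := by
  constructor
  · intro h
    funext ⟨i, l⟩
    have := T_mulVec_coords D w i
    rw [h i, mulVec_zero] at this
    exact (congrFun this l).symm
  · rintro rfl i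
    exact mulVec_zero _

theorem bigT_mulVec (D : (i : Fin N) → ObsDecomp (H i) A)
    (Z : ((i : Fin N) × (Fin (D i).v ⊕ Fin (n - (D i).v))) → ℝ) (i : Fin N) (k : Fin n) :
    (bigT D *ᵥ Z) (i, k) = ((D i).T *ᵥ fun a => Z ⟨i, a⟩) k := by
  simp only [mulVec, dotProduct, Fintype.sum_sigma]
  rw [Finset.sum_eq_single i]
  · simp [bigT, blockDiagonal'_apply, Equiv.sigmaEquivProd]
  · intro j _ hj
    simp [bigT, blockDiagonal'_apply, Equiv.sigmaEquivProd, hj.symm]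
  · simp

theorem coords_bigT_mulVec (D : (i : Fin N) → ObsDecomp (H i) A)
    (Z : ((i : Fin N) × (Fin (D i).v ⊕ Fin (n - (D i).v))) → ℝ) (i : Fin N) :
    coords D (bigT D *ᵥ Z) i = fun a => Z ⟨i, a⟩ := by
  have : (fun l => (bigT D *ᵥ Z) (i, l)) = (D i).T *ᵥ fun a => Z ⟨i, a⟩ :=
    funext fun l => bigT_mulVec D Z i l
  rw [coords, this, mulVec_mulVec, (D i).transpose_mul_self, one_mulVec]

theorem bigG_dotProduct (D : (i : Fin N) → ObsDecomp (H i) A)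
    (Z : ((i : Fin N) × (Fin (D i).v ⊕ Fin (n - (D i).v))) → ℝ) :
    Z ⬝ᵥ bigG D *ᵥ Z = ∑ i, (fun a => Z ⟨i, Sum.inl a⟩) ⬝ᵥ fun a => Z ⟨i, Sum.inl a⟩ := by
  rw [dotProduct, Fintype.sum_sigma]
  refine Finset.sum_congr rfl fun i _ => ?_
  have h : ∀ a, (bigG D *ᵥ Z) ⟨i, a⟩
      = (fromBlocks (1 : Matrix (Fin (D i).v) (Fin (D i).v) ℝ) 0 0 0 *ᵥ fun a => Z ⟨i, a⟩) a := by
    intro a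
    simp only [mulVec, dotProduct, Fintype.sum_sigma]
    rw [Finset.sum_eq_single i]
    · simp [bigG, blockDiagonal'_apply]
    · intro j _ hj
      simp [bigG, blockDiagonal'_apply, hj.symm]
    · simp
  simp only [h]
  have := fromBlocks_dotProduct (1 : Matrix (Fin (D i).v) (Fin (D i).v) ℝ) 0 0
    (0 : Matrix (Fin (n - (D i).v)) (Fin (n - (D i).v)) ℝ) fun a => Z ⟨i, a⟩
  simp only [one_mulVec, zero_mulVec, dotProduct_zero, add_zero] at this
  exact this

/-- The quadratic form of `(R 𝓛 + 𝓛ᵀ R) ⊗ Iₙ`. -/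
def couplingForm (G : WeightedDigraph N) (r : Fin N → ℝ) (w : Fin N × Fin n → ℝ) : ℝ :=
  w ⬝ᵥ (G.mirrorLaplacian r ⊗ₖ (1 : Matrix (Fin n) (Fin n) ℝ)) *ᵥ w

theorem couplingForm_eq (hr : r ᵥ* G.laplacian = 0) (w : Fin N × Fin n → ℝ) :
    couplingForm G r w
      = ∑ k, ∑ i, ∑ j, r i * G.weight i j * (w (i, k) - w (j, k)) ^ 2 := by
  rw [couplingForm, kronecker_one_dotProduct]
  exact Finset.sum_congr rfl fun k _ => by
    rw [WeightedDigraph.mirrorLaplacian_dotProduct,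
      WeightedDigraph.diagonal_mul_laplacian_dotProduct hr]

theorem couplingForm_nonneg (hr : G.IsNormalizedLeftNull r) (w : Fin N × Fin n → ℝ) :
    0 ≤ couplingForm G r w := by
  rw [couplingForm_eq hr.2.1]
  exact Finset.sum_nonneg fun k _ => Finset.sum_nonneg fun i _ => Finset.sum_nonneg fun j _ =>
    mul_nonneg (mul_nonneg (hr.1 i).le (G.weight_nonneg i j)) (sq_nonneg _)

theorem eq_of_couplingForm_eq_zero (hG : G.IsStronglyConnected) (hr : G.IsNormalizedLeftNull r)
    {w : Fin N × Fin n → ℝ} (hw : couplingForm G r w = 0) (i j : Fin N) (k : Fin n) :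
    w (i, k) = w (j, k) := by
  rw [couplingForm_eq hr.2.1] at hw
  have := (Finset.sum_eq_zero_iff_of_nonneg fun k _ => Finset.sum_nonneg fun i _ =>
    Finset.sum_nonneg fun j _ =>
      mul_nonneg (mul_nonneg (hr.1 i).le (G.weight_nonneg i j)) (sq_nonneg _)).1 hw k
      (Finset.mem_univ k)
  exact WeightedDigraph.eq_of_sum_weight_mul_sq_eq_zero (x := fun i => w (i, k)) hG hr.1 this i j

theorem transformed_dotProduct (D : (i : Fin N) → ObsDecomp (H i) A)
    (Z : ((i : Fin N) × (Fin (D i).v ⊕ Fin (n - (D i).v))) → ℝ) :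
    Z ⬝ᵥ ((bigT D)ᵀ * (G.mirrorLaplacian r ⊗ₖ (1 : Matrix (Fin n) (Fin n) ℝ)) * bigT D
      + bigG D) *ᵥ Z = couplingForm G r (bigT D *ᵥ Z)
        + ∑ i, (coords D (bigT D *ᵥ Z) i ∘ Sum.inl) ⬝ᵥ (coords D (bigT D *ᵥ Z) i ∘ Sum.inl) := by
  rw [add_mulVec, dotProduct_add, bigG_dotProduct, ← mulVec_mulVec, ← mulVec_mulVec,
    dotProduct_mulVec, vecMul_transpose]
  simp only [coords_bigT_mulVec]
  rfl

theorem isHermitian_transformed (D : (i : Fin N) → ObsDecomp (H i) A) :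
    ((bigT D)ᵀ * (G.mirrorLaplacian r ⊗ₖ (1 : Matrix (Fin n) (Fin n) ℝ)) * bigT D
      + bigG D).IsHermitian := by
  have h1 : (G.mirrorLaplacian r)ᵀ = G.mirrorLaplacian r := by
    simp [WeightedDigraph.mirrorLaplacian, add_comm]
  have h2 : (bigG D)ᵀ = bigG D := by
    rw [bigG, blockDiagonal'_transpose]
    congr 1
    funext i
    simp [fromBlocks_transpose]
  rw [IsHermitian, conjTranspose_eq_transpose_of_trivial, transpose_add, transpose_mul,
    transpose_mul, transpose_transpose, h2, ← kroneckerMap_transpose, h1, transpose_one,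
    Matrix.mul_assoc]

theorem exists_epsCondition (hN : 0 < N) (hobs : IsObservable (stack H) A)
    (hG : G.IsStronglyConnected) (hr : G.IsNormalizedLeftNull r)
    (D : (i : Fin N) → ObsDecomp (H i) A) : ∃ ε, EpsCondition G r D ε := by
  have hpd : ((bigT D)ᵀ * (G.mirrorLaplacian r ⊗ₖ (1 : Matrix (Fin n) (Fin n) ℝ)) * bigT D
      + bigG D).PosDef := by
    refine PosDef.of_dotProduct_mulVec_pos (isHermitian_transformed D) fun Z hZ => ?_
    rw [star_trivial, transformed_dotProduct]
    have h1 := couplingForm_nonneg hr (bigT D *ᵥ Z)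
    have h2 : ∀ i ∈ Finset.univ, 0 ≤ (coords D (bigT D *ᵥ Z) i ∘ Sum.inl)
        ⬝ᵥ (coords D (bigT D *ᵥ Z) i ∘ Sum.inl) := fun i _ =>
      Finset.sum_nonneg fun a _ => mul_self_nonneg _
    have h3 := Finset.sum_nonneg h2
    refine lt_of_le_of_ne (add_nonneg h1 h3) fun h => hZ ?_
    have h4 := eq_of_couplingForm_eq_zero hG hr (w := bigT D *ᵥ Z) (by linarith)
    have h5 := (Finset.sum_eq_zero_iff_of_nonneg h2).1 (by linarith)
    set w := bigT D *ᵥ Z with hw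
    -- All nodes carry the same vector, and it is unobservable from each `H i`, hence from the
    -- stacked output.
    have h6 : (fun l => w (⟨0, hN⟩, l)) = 0 := by
      refine (isObservable_iff _ _).1 hobs _ fun k => ?_
      ext ⟨i, a⟩
      have h7 : (fun l => w (⟨0, hN⟩, l)) = fun l => w (i, l) := funext fun l => h4 _ _ l
      have h8 := (D i).mul_pow_mulVec_eq_zero
        (dotProduct_self_eq_zero.1 (h5 i (Finset.mem_univ i))) k
      rw [h7]
      exact congrFun h8 a
    have h7 : w = 0 := by
      funext ⟨i, l⟩
      rw [h4 i ⟨0, hN⟩ l]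
      exact congrFun h6 l
    funext ⟨i, a⟩
    have h8 := congrFun (coords_bigT_mulVec D Z i) a
    rw [← h8, ← hw, (coords_eq_zero_iff D w).2 h7 i]
    rfl
  obtain ⟨c, hc, hcM⟩ := exists_pos_le_dotProduct_mulVec hpd
  -- Halving `c` makes the inequality strict.
  refine ⟨c / 2, half_pos hc, PosDef.of_dotProduct_mulVec_pos ?_ fun Z hZ => ?_⟩
  · exact hpd.isHermitian.sub (by simp [IsHermitian])
  · rw [star_trivial, sub_mulVec, dotProduct_sub, smul_mulVec, one_mulVec, dotProduct_smul,
      smul_eq_mul]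
    have h1 := hcM Z
    have h2 : 0 < Z ⬝ᵥ Z := by
      simpa using dotProduct_star_self_pos_iff.2 hZ
    nlinarith

/-- The matrix inequality in the original error coordinates; every `w` is reached because the blocks
`T_i` are orthogonal. -/
theorem EpsCondition.lt {D : (i : Fin N) → ObsDecomp (H i) A} (hε : EpsCondition G r D ε)
    {w : Fin N × Fin n → ℝ} (hw : w ≠ 0) :
    ε * ∑ i, coords D w i ⬝ᵥ coords D w i
      < couplingForm G r w + ∑ i, (coords D w i ∘ Sum.inl) ⬝ᵥ (coords D w i ∘ Sum.inl) := by
  set Z : ((i : Fin N) × (Fin (D i).v ⊕ Fin (n - (D i).v))) → ℝ := fun ia => coords D w ia.1 ia.2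
    with hZ
  have hTZ : bigT D *ᵥ Z = w := by
    funext ⟨i, k⟩
    rw [bigT_mulVec]
    exact congrFun (T_mulVec_coords D w i) k
  have hZ0 : Z ≠ 0 := fun h => hw (by rw [← hTZ, h, mulVec_zero])
  have h := hε.2.dotProduct_mulVec_pos hZ0
  rw [star_trivial, sub_mulVec, dotProduct_sub, transformed_dotProduct, hTZ, smul_mulVec,
    one_mulVec, dotProduct_smul, smul_eq_mul, dotProduct, Fintype.sum_sigma] at h
  exact sub_pos.1 h

/-- On a constant vector the coupling form vanishes, and the observable part is no longer than the
whole vector. -/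
theorem EpsCondition.lt_one (hN : 0 < N) (hn : 0 < n) (hr : r ᵥ* G.laplacian = 0)
    {D : (i : Fin N) → ObsDecomp (H i) A} (hε : EpsCondition G r D ε) : ε < 1 := by
  have hw : (fun _ => 1 : Fin N × Fin n → ℝ) ≠ 0 :=
    Function.ne_iff.2 ⟨(⟨0, hN⟩, ⟨0, hn⟩), one_ne_zero⟩
  have h := hε.lt hw
  have h0 : couplingForm G r (fun _ => 1 : Fin N × Fin n → ℝ) = 0 := by
    rw [couplingForm_eq hr]; simp
  set w : Fin N × Fin n → ℝ := fun _ => 1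
  have h1 : ∑ i, (coords D w i ∘ Sum.inl) ⬝ᵥ (coords D w i ∘ Sum.inl)
      ≤ ∑ i, coords D w i ⬝ᵥ coords D w i := Finset.sum_le_sum fun i _ => by
    rw [dotProduct_self_sum_elim (coords D w i)]
    exact le_add_of_nonneg_right (Finset.sum_nonneg fun a _ => mul_self_nonneg _)
  have h2 : 0 ≤ ∑ i, coords D w i ⬝ᵥ coords D w i := Finset.sum_nonneg fun i _ =>
    Finset.sum_nonneg fun a _ => mul_self_nonneg _
  by_contra hle
  nlinarith

theorem exists_gammaCondition (D : (i : Fin N) → ObsDecomp (H i) A) (hα : 0 < α) (hε : 0 < ε) :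
    ∃ γ₀ : ℝ, ∀ γ : ℝ, γ₀ ≤ γ → GammaCondition D α ε γ := by
  choose C₁ hC₁ hX using fun i => exists_dotProduct_mulVec_le ((D i).Au + (D i).Auᵀ)
  choose C₂ hC₂ hY using fun i => exists_dotProduct_mulVec_le ((D i).Ar * (D i).Arᵀ)
  have hS : ∀ i, C₁ i + C₂ i ≤ ∑ i, (C₁ i + C₂ i) := fun i =>
    Finset.single_le_sum (f := fun i => C₁ i + C₂ i) (fun i _ => add_nonneg (hC₁ i) (hC₂ i))
      (Finset.mem_univ i)
  have hS0 : 0 ≤ ∑ i, (C₁ i + C₂ i) := Finset.sum_nonneg fun i _ => add_nonneg (hC₁ i) (hC₂ i)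
  -- This gives `c = γε - 2α ≥ 1 + ∑ (C₁ i + C₂ i)`: then `1 / c ≤ 1`, and `c` dominates both
  -- quadratic forms at every node.
  refine ⟨(2 * α + 1 + ∑ i, (C₁ i + C₂ i)) / ε, fun γ hγ => ?_⟩
  rw [div_le_iff₀ hε] at hγ
  have hγ0 : 0 < γ := by
    by_contra h
    nlinarith
  refine ⟨hγ0, by linarith, fun i => ?_⟩
  set c := γ * ε - 2 * α with hc
  have hc1 : 1 ≤ c := by linarith
  refine PosDef.of_dotProduct_mulVec_pos ?_ fun x hx => ?_
  · simp [IsHermitian, add_comm]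
  · have hxx : 0 < x ⬝ᵥ x := by simpa using dotProduct_star_self_pos_iff.2 hx
    rw [star_trivial, neg_mulVec, dotProduct_neg, add_mulVec, sub_mulVec, dotProduct_add,
      dotProduct_sub, smul_mulVec, smul_mulVec, one_mulVec, dotProduct_smul, dotProduct_smul,
      smul_eq_mul, smul_eq_mul]
    have h1 := hX i x
    have h2 : 1 / c * (x ⬝ᵥ ((D i).Ar * (D i).Arᵀ) *ᵥ x) ≤ C₂ i * (x ⬝ᵥ x) := by
      have h3 : 0 ≤ x ⬝ᵥ ((D i).Ar * (D i).Arᵀ) *ᵥ x := by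
        simpa using (posSemidef_self_mul_conjTranspose (D i).Ar).dotProduct_mulVec_nonneg x
      have h4 : 1 / c ≤ 1 := (div_le_one (by linarith)).2 hc1
      exact (mul_le_of_le_one_left h3 h4).trans (hY i x)
    have h5 := hS i
    nlinarith

theorem exists_lyapunovCondition (hN : 0 < N) (hr : r ᵥ* G.laplacian = 0)
    {D : (i : Fin N) → ObsDecomp (H i) A} (hε : EpsCondition G r D ε)
    (hγ : GammaCondition D α ε γ) {Lo : (i : Fin N) → Matrix (Fin (D i).v) (Fin (p i)) ℝ}
    (hLo : PoleCondition D α Lo) :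
    ∃ Po : (i : Fin N) → Matrix (Fin (D i).v) (Fin (D i).v) ℝ, LyapunovCondition D α γ Lo Po := by
  -- For `n = 0` the bound `ε < 1` is not available, but all matrices are empty.
  rcases Nat.eq_zero_or_pos n with hn | hn
  · have hv : ∀ i, IsEmpty (Fin (D i).v) := fun i =>
      ⟨fun a => absurd a.2 (by have := (D i).v_le; omega)⟩
    exact ⟨fun _ => 1, fun i => ⟨PosDef.one, by ext a; exact (hv i).elim a⟩⟩
  have hγα : 0 < γ - 2 * α := by
    have h1 := hε.lt_one hN hn hr
    have h2 := hγ.1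
    have h3 := hγ.2.1
    nlinarith
  have key : ∀ i, ∃ P : Matrix (Fin (D i).v) (Fin (D i).v) ℝ, P.PosDef ∧
      symPart (P * ((D i).Ao - Lo i * (D i).Ho + α • 1)) + (γ - 2 * α) • 1 = 0 := by
    intro i
    set B := (D i).Ao - Lo i * (D i).Ho with hB
    have hF : ∀ s ∈ spectrum ℂ ((B + α • (1 : Matrix _ _ ℝ)).map (algebraMap ℝ ℂ)), s.re < 0 := by
      intro s hs
      obtain ⟨v, hv, hs⟩ := exists_mulVec_eq_smul_of_mem_spectrum hs
      have hm : (B + α • (1 : Matrix _ _ ℝ)).map (algebraMap ℝ ℂ)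
          = B.map (algebraMap ℝ ℂ) + (α : ℂ) • (1 : Matrix _ _ ℂ) := by
        ext a b
        by_cases hab : a = b <;> simp [hab]
      rw [hm, add_mulVec, smul_mulVec, one_mulVec] at hs
      have h1 : B.map (algebraMap ℝ ℂ) *ᵥ v = (s - α) • v := by
        rw [sub_smul, ← hs]; abel
      have h2 := hLo i _ (mem_spectrum_of_mulVec_eq_smul hv h1)
      simp at h2
      linarith
    obtain ⟨P, hP, h⟩ := exists_posDef_lyapunov hF (PosDef.one.smul hγα)
    refine ⟨P, hP, ?_⟩
    have hPt : Pᵀ = P := by simpa using hP.isHermitian.eq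
    rw [symPart, transpose_mul, hPt, h, neg_add_cancel]
  choose P hP using key
  exact ⟨P, hP⟩

/-- The local Lyapunov matrices `Tᵢ diag(P_o, I) Tᵢᵀ`. -/
def lyapunovBlock (D : (i : Fin N) → ObsDecomp (H i) A)
    (Po : (i : Fin N) → Matrix (Fin (D i).v) (Fin (D i).v) ℝ) (i : Fin N) :
    Matrix (Fin n) (Fin n) ℝ :=
  (D i).T * (fromBlocks (Po i) 0 0 1 :
    Matrix (Fin (D i).v ⊕ Fin (n - (D i).v)) (Fin (D i).v ⊕ Fin (n - (D i).v)) ℝ) * (D i).Tᵀ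

/-- The reason for the form of `M_i`: weighting the error system with the Lyapunov matrix removes
the gain from the coupling term. -/
theorem lyapunovBlock_mul_gainM (D : (i : Fin N) → ObsDecomp (H i) A)
    {Po : (i : Fin N) → Matrix (Fin (D i).v) (Fin (D i).v) ℝ} (i : Fin N) (hP : (Po i).PosDef) :
    lyapunovBlock D Po i * gainM D Po i = 1 := by
  have hu : Po i * (Po i)⁻¹ = 1 := mul_nonsing_inv _ ((isUnit_iff_isUnit_det _).1 hP.isUnit)
  calc lyapunovBlock D Po i * gainM D Po i
      = (D i).T * ((fromBlocks (Po i) 0 0 1) * ((D i).Tᵀ * (D i).T)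
          * fromBlocks (Po i)⁻¹ 0 0 1) * (D i).Tᵀ := by
        simp only [lyapunovBlock, gainM, Matrix.mul_assoc]
    _ = 1 := by
        rw [(D i).transpose_mul_self, Matrix.mul_one, fromBlocks_multiply]
        simp [hu, (D i).orthogonal]

theorem conj_dotProduct (D : (i : Fin N) → ObsDecomp (H i) A) (i : Fin N)
    (B : Matrix (Fin (D i).v ⊕ Fin (n - (D i).v)) (Fin (D i).v ⊕ Fin (n - (D i).v)) ℝ)
    (w : Fin N × Fin n → ℝ) :
    (fun l => w (i, l)) ⬝ᵥ ((D i).T * B * (D i).Tᵀ) *ᵥ (fun l => w (i, l))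
      = coords D w i ⬝ᵥ B *ᵥ coords D w i := by
  rw [← mulVec_mulVec, ← mulVec_mulVec, dotProduct_mulVec, ← mulVec_transpose]
  rfl

theorem lyapunovBlock_mul_sub (D : (i : Fin N) → ObsDecomp (H i) A)
    (Lo : (i : Fin N) → Matrix (Fin (D i).v) (Fin (p i)) ℝ)
    (Po : (i : Fin N) → Matrix (Fin (D i).v) (Fin (D i).v) ℝ) (i : Fin N) :
    lyapunovBlock D Po i * (A - gainL D Lo i * H i)
      = (D i).T * fromBlocks (Po i * ((D i).Ao - Lo i * (D i).Ho)) 0 (D i).Ar (D i).Au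
        * (D i).Tᵀ := by
  have h1 : (D i).Tᵀ * (A - gainL D Lo i * H i) * (D i).T
      = fromBlocks ((D i).Ao - Lo i * (D i).Ho) 0 (D i).Ar (D i).Au := by
    have hA : (D i).Tᵀ * A * (D i).T = fromBlocks (D i).Ao 0 (D i).Ar (D i).Au := by
      conv_lhs => rw [← fromBlocks_toBlocks ((D i).Tᵀ * A * (D i).T), (D i).block_zero]
      rfl
    have hH : H i * (D i).T = fromCols (D i).Ho 0 := by
      conv_lhs => rw [← fromCols_toCols (H i * (D i).T), (D i).cols_zero]
      rfl
    have hL : (D i).Tᵀ * (gainL D Lo i * H i) * (D i).T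
        = fromBlocks (Lo i * (D i).Ho) 0 0 0 := by
      rw [gainL, Matrix.mul_assoc, Matrix.mul_assoc, Matrix.mul_assoc, hH, ← Matrix.mul_assoc,
        (D i).transpose_mul_self, Matrix.one_mul, fromRows_mul_fromCols]
      simp
    rw [Matrix.mul_sub, Matrix.sub_mul, hA, hL, sub_eq_add_neg, fromBlocks_neg, fromBlocks_add]
    simp [sub_eq_add_neg]
  have h2 : A - gainL D Lo i * H i
      = (D i).T * ((D i).Tᵀ * (A - gainL D Lo i * H i) * (D i).T) * (D i).Tᵀ := by
    calc A - gainL D Lo i * H i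
        = ((D i).T * (D i).Tᵀ) * (A - gainL D Lo i * H i) * ((D i).T * (D i).Tᵀ) := by
          rw [(D i).orthogonal, Matrix.one_mul, Matrix.mul_one]
      _ = _ := by simp only [Matrix.mul_assoc]
  rw [h2, h1]
  calc lyapunovBlock D Po i * ((D i).T
        * fromBlocks ((D i).Ao - Lo i * (D i).Ho) 0 (D i).Ar (D i).Au * (D i).Tᵀ)
      = (D i).T * (fromBlocks (Po i) 0 0 1 * ((D i).Tᵀ * (D i).T)
        * fromBlocks ((D i).Ao - Lo i * (D i).Ho) 0 (D i).Ar (D i).Au) * (D i).Tᵀ := by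
        simp only [lyapunovBlock, Matrix.mul_assoc]
    _ = _ := by
        rw [(D i).transpose_mul_self, Matrix.mul_one, fromBlocks_multiply]
        simp

theorem lyapunovBlock_dotProduct (D : (i : Fin N) → ObsDecomp (H i) A)
    (Po : (i : Fin N) → Matrix (Fin (D i).v) (Fin (D i).v) ℝ) (w : Fin N × Fin n → ℝ)
    (i : Fin N) :
    (fun l => w (i, l)) ⬝ᵥ lyapunovBlock D Po i *ᵥ (fun l => w (i, l))
      = (coords D w i ∘ Sum.inl) ⬝ᵥ Po i *ᵥ (coords D w i ∘ Sum.inl)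
        + (coords D w i ∘ Sum.inr) ⬝ᵥ (coords D w i ∘ Sum.inr) := by
  rw [lyapunovBlock, conj_dotProduct, fromBlocks_dotProduct]
  simp

theorem posDef_diagBlocks_lyapunovBlock (D : (i : Fin N) → ObsDecomp (H i) A)
    {Po : (i : Fin N) → Matrix (Fin (D i).v) (Fin (D i).v) ℝ} (hP : ∀ i, (Po i).PosDef) :
    (diagBlocks (lyapunovBlock D Po)).PosDef := by
  have ht : ∀ i, (lyapunovBlock D Po i)ᵀ = lyapunovBlock D Po i := fun i => by
    have hPt : (Po i)ᵀ = Po i := by simpa using (hP i).isHermitian.eq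
    simp [lyapunovBlock, fromBlocks_transpose, hPt, Matrix.mul_assoc]
  refine PosDef.of_dotProduct_mulVec_pos ?_ fun w hw => ?_
  · ext ⟨i, k⟩ ⟨j, l⟩
    by_cases hij : i = j
    · subst hij
      simpa [diagBlocks] using congrFun (congrFun (ht i) k) l
    · simp [diagBlocks, hij, Ne.symm hij]
  · rw [star_trivial, diagBlocks_dotProduct]
    simp only [lyapunovBlock_dotProduct]
    have h1 : ∀ i, 0 ≤ (coords D w i ∘ Sum.inl) ⬝ᵥ Po i *ᵥ (coords D w i ∘ Sum.inl) := fun i => by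
      simpa using (hP i).posSemidef.dotProduct_mulVec_nonneg (coords D w i ∘ Sum.inl)
    have h2 : ∀ i, 0 ≤ (coords D w i ∘ Sum.inr) ⬝ᵥ (coords D w i ∘ Sum.inr) := fun i =>
      Finset.sum_nonneg fun a _ => mul_self_nonneg _
    have h3 : ∀ i ∈ Finset.univ, 0 ≤ (coords D w i ∘ Sum.inl) ⬝ᵥ Po i *ᵥ (coords D w i ∘ Sum.inl)
        + (coords D w i ∘ Sum.inr) ⬝ᵥ (coords D w i ∘ Sum.inr) := fun i _ =>
      add_nonneg (h1 i) (h2 i)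
    refine lt_of_le_of_ne (Finset.sum_nonneg h3) fun h => hw ?_
    rw [← coords_eq_zero_iff D]
    intro i
    have h4 := (Finset.sum_eq_zero_iff_of_nonneg h3).1 h.symm i (Finset.mem_univ i)
    have h5 := h1 i
    have h6 := h2 i
    have ho : coords D w i ∘ Sum.inl = 0 := by
      by_contra hne
      have := (hP i).dotProduct_mulVec_pos hne
      rw [star_trivial] at this
      linarith
    have hu : coords D w i ∘ Sum.inr = 0 := dotProduct_self_eq_zero.1 (by linarith)
    funext a
    rcases a with a | a
    · exact congrFun ho a
    · exact congrFun hu a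

/-- The dissipation inequality at a single node. -/
theorem local_dissipation {D : (i : Fin N) → ObsDecomp (H i) A} (hγ : GammaCondition D α ε γ)
    {Lo : (i : Fin N) → Matrix (Fin (D i).v) (Fin (p i)) ℝ}
    {Po : (i : Fin N) → Matrix (Fin (D i).v) (Fin (D i).v) ℝ}
    (hPo : LyapunovCondition D α γ Lo Po) (w : Fin N × Fin n → ℝ) (i : Fin N) :
    2 * ((fun l => w (i, l)) ⬝ᵥ (lyapunovBlock D Po i * (A - gainL D Lo i * H i)) *ᵥ
        (fun l => w (i, l)))
      + 2 * α * ((fun l => w (i, l)) ⬝ᵥ lyapunovBlock D Po i *ᵥ (fun l => w (i, l)))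
      ≤ γ * (ε * (coords D w i ⬝ᵥ coords D w i)
        - (coords D w i ∘ Sum.inl) ⬝ᵥ (coords D w i ∘ Sum.inl)) := by
  rw [lyapunovBlock_mul_sub, conj_dotProduct, fromBlocks_dotProduct, lyapunovBlock_dotProduct,
    dotProduct_self_sum_elim (coords D w i)]
  obtain ⟨-, hc0, hγ⟩ := hγ
  have hγi := (hγ i).posSemidef.dotProduct_mulVec_nonneg (coords D w i ∘ Sum.inr)
  obtain ⟨hP, hL⟩ := hPo i
  set x := coords D w i ∘ Sum.inl
  set y := coords D w i ∘ Sum.inr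
  set B := (D i).Ao - Lo i * (D i).Ho
  set c := γ * ε - 2 * α with hc
  have hcpos : 0 < c := sub_pos.2 hc0
  have hsym : ∀ {m : ℕ} (M : Matrix (Fin m) (Fin m) ℝ) (u : Fin m → ℝ),
      u ⬝ᵥ Mᵀ *ᵥ u = u ⬝ᵥ M *ᵥ u :=
    fun M u => by rw [mulVec_transpose, dotProduct_comm, ← dotProduct_mulVec]
  have h1 : 2 * (x ⬝ᵥ (Po i * B) *ᵥ x) + 2 * α * (x ⬝ᵥ Po i *ᵥ x) + (γ - 2 * α) * (x ⬝ᵥ x) = 0 := by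
    have := congrArg (fun M => x ⬝ᵥ M *ᵥ x) hL
    simp only [symPart, add_mulVec, dotProduct_add, hsym, Matrix.mul_add, Matrix.mul_smul,
      Matrix.mul_one, smul_mulVec, one_mulVec, dotProduct_smul, smul_eq_mul, zero_mulVec,
      dotProduct_zero] at this
    linarith
  have h2 : 2 * (y ⬝ᵥ (D i).Au *ᵥ y) - c * (y ⬝ᵥ y)
      + 1 / c * (((D i).Arᵀ *ᵥ y) ⬝ᵥ ((D i).Arᵀ *ᵥ y)) ≤ 0 := by
    rw [star_trivial, neg_mulVec, dotProduct_neg, add_mulVec, sub_mulVec, add_mulVec,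
      dotProduct_add, dotProduct_sub, dotProduct_add, hsym, smul_mulVec, smul_mulVec, one_mulVec,
      dotProduct_smul, dotProduct_smul, smul_eq_mul, smul_eq_mul, ← mulVec_mulVec,
      dotProduct_mulVec y (D i).Ar, ← mulVec_transpose] at hγi
    linarith
  have h3 : 2 * (y ⬝ᵥ (D i).Ar *ᵥ x)
      ≤ c * (x ⬝ᵥ x) + 1 / c * (((D i).Arᵀ *ᵥ y) ⬝ᵥ ((D i).Arᵀ *ᵥ y)) := by
    rw [dotProduct_mulVec, ← mulVec_transpose]
    set u := (D i).Arᵀ *ᵥ y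
    have h4 : 0 ≤ 1 / c * ((c • x - u) ⬝ᵥ (c • x - u)) :=
      mul_nonneg (one_div_nonneg.2 hcpos.le) (Finset.sum_nonneg fun a _ => mul_self_nonneg _)
    have h5 : 1 / c * ((c • x - u) ⬝ᵥ (c • x - u))
        = c * (x ⬝ᵥ x) - 2 * (u ⬝ᵥ x) + 1 / c * (u ⬝ᵥ u) := by
      simp only [sub_dotProduct, dotProduct_sub, smul_dotProduct, dotProduct_smul, smul_eq_mul,
        dotProduct_comm x u]
      field_simp
      ring
    linarith
  simp only [zero_mulVec, dotProduct_zero]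
  have hγε : γ * ε = c + 2 * α := by rw [hc]; ring
  -- The coefficients match exactly: `-(γ - 2α) + c` on `|x|²` and `c + 2α` on `|y|²`, where `c + 2α
  -- = γε`.
  have h6 : γ * (ε * (x ⬝ᵥ x + y ⬝ᵥ y) - x ⬝ᵥ x)
      = (c + 2 * α) * (x ⬝ᵥ x + y ⬝ᵥ y) - γ * (x ⬝ᵥ x) := by rw [← hγε]; ring
  rw [h6]
  linarith

/-- The indefinite local bounds are summed over the nodes; the coupling form, multiplied by `γ`,
pays for the directions that no single node observes. -/
theorem errorsDecayAtRate_of_design {D : (i : Fin N) → ObsDecomp (H i) A}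
    (hε : EpsCondition G r D ε) (hγ : GammaCondition D α ε γ)
    {Lo : (i : Fin N) → Matrix (Fin (D i).v) (Fin (p i)) ℝ}
    {Po : (i : Fin N) → Matrix (Fin (D i).v) (Fin (D i).v) ℝ}
    (hPo : LyapunovCondition D α γ Lo Po) :
    ErrorsDecayAtRate A H G r γ (gainL D Lo) (gainM D Po) α := by
  refine norm_le_of_lyapunov (posDef_diagBlocks_lyapunovBlock D fun i => (hPo i).1) fun w => ?_
  have hSM : diagBlocks (lyapunovBlock D Po) * diagBlocks (gainM D Po) = 1 := by
    rw [diagBlocks_mul]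
    ext ⟨i, k⟩ ⟨j, l⟩
    simp only [lyapunovBlock_mul_gainM D _ (hPo _).1]
    by_cases hij : i = j <;> simp [diagBlocks, Matrix.one_apply, hij]
  have hSE : diagBlocks (lyapunovBlock D Po) * errorMatrix A H G r γ (gainL D Lo) (gainM D Po)
      = diagBlocks (fun i => lyapunovBlock D Po i * (A - gainL D Lo i * H i))
        - γ • ((diagonal r * G.laplacian) ⊗ₖ (1 : Matrix (Fin n) (Fin n) ℝ)) := by
    rw [errorMatrix, Matrix.mul_sub, diagBlocks_mul, Matrix.mul_smul, ← Matrix.mul_assoc, hSM,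
      Matrix.one_mul]
  have hK : 2 * (w ⬝ᵥ ((diagonal r * G.laplacian) ⊗ₖ (1 : Matrix (Fin n) (Fin n) ℝ)) *ᵥ w)
      = couplingForm G r w := by
    rw [couplingForm, kronecker_one_dotProduct, kronecker_one_dotProduct, Finset.mul_sum]
    simp only [WeightedDigraph.mirrorLaplacian_dotProduct]
  have hle : ε * ∑ i, coords D w i ⬝ᵥ coords D w i
      ≤ couplingForm G r w + ∑ i, (coords D w i ∘ Sum.inl) ⬝ᵥ (coords D w i ∘ Sum.inl) := by
    by_cases hw : w = 0
    · subst hw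
      simp [(coords_eq_zero_iff D 0).2 rfl, couplingForm]
    · exact (hε.lt hw).le
  have hsum := Finset.sum_le_sum fun i (_ : i ∈ Finset.univ) => local_dissipation hγ hPo w i
  rw [Finset.sum_add_distrib, ← Finset.mul_sum, ← Finset.mul_sum, ← Finset.mul_sum,
    Finset.sum_sub_distrib, ← Finset.mul_sum] at hsum
  rw [mulVec_mulVec, hSE, sub_mulVec, dotProduct_sub, smul_mulVec, dotProduct_smul, smul_eq_mul,
    diagBlocks_dotProduct, diagBlocks_dotProduct]
  have h := mul_le_mul_of_nonneg_left hle hγ.1.le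
  rw [← hK] at h
  linarith

end Design
end DistObs

theorem theorem6 (N n : ℕ) (hN : 0 < N) (p : Fin N → ℕ)
    (A : Matrix (Fin n) (Fin n) ℝ)
    (H : (i : Fin N) → Matrix (Fin (p i)) (Fin n) ℝ)
    (G : DistObs.WeightedDigraph N)
    (hobs : DistObs.IsObservable (DistObs.stack H) A)
    (hconn : G.IsStronglyConnected)
    (α : ℝ) (hα : 0 < α) :
    -- existence of the observer
    (∃ r : Fin N → ℝ, G.IsNormalizedLeftNull r ∧
      ∃ (γ : ℝ) (L : (i : Fin N) → Matrix (Fin n) (Fin (p i)) ℝ)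
        (M : Fin N → Matrix (Fin n) (Fin n) ℝ),
        DistObs.AchievesOmniscience A H G r γ L M ∧
        DistObs.ErrorsDecayAtRate A H G r γ L M α) ∧
    -- each step of the procedure can be carried out, whatever was chosen before,
    -- and each outcome is such an observer
    (∀ i, Nonempty (DistObs.ObsDecomp (H i) A)) ∧
    (∃! r : Fin N → ℝ, G.IsNormalizedLeftNull r) ∧
    (∀ (D : (i : Fin N) → DistObs.ObsDecomp (H i) A) (r : Fin N → ℝ),
      G.IsNormalizedLeftNull r →
      (∃ ε : ℝ, DistObs.EpsCondition G r D ε) ∧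
      ∀ ε : ℝ, DistObs.EpsCondition G r D ε →
        (∃ γ₀ : ℝ, ∀ γ : ℝ, γ₀ ≤ γ → DistObs.GammaCondition D α ε γ) ∧
        ∀ γ : ℝ, DistObs.GammaCondition D α ε γ →
          (∃ Lo : (i : Fin N) → Matrix (Fin (D i).v) (Fin (p i)) ℝ,
            DistObs.PoleCondition D α Lo) ∧
          ∀ Lo : (i : Fin N) → Matrix (Fin (D i).v) (Fin (p i)) ℝ,
            DistObs.PoleCondition D α Lo →
            (∃ Po : (i : Fin N) → Matrix (Fin (D i).v) (Fin (D i).v) ℝ,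
              DistObs.LyapunovCondition D α γ Lo Po) ∧
            ∀ Po : (i : Fin N) → Matrix (Fin (D i).v) (Fin (D i).v) ℝ,
              DistObs.LyapunovCondition D α γ Lo Po →
              DistObs.AchievesOmniscience A H G r γ
                (DistObs.gainL D Lo) (DistObs.gainM D Po) ∧
              DistObs.ErrorsDecayAtRate A H G r γ
                (DistObs.gainL D Lo) (DistObs.gainM D Po) α) := by
  have hD : ∀ i, Nonempty (DistObs.ObsDecomp (H i) A) := fun i =>
    DistObs.nonempty_obsDecomp (H i) A
  have hr := DistObs.WeightedDigraph.existsUnique_isNormalizedLeftNull hN hconn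
  have hLo : ∀ D : (i : Fin N) → DistObs.ObsDecomp (H i) A,
      ∃ Lo : (i : Fin N) → Matrix (Fin (D i).v) (Fin (p i)) ℝ, DistObs.PoleCondition D α Lo :=
    fun D => by
      choose Lo hLo using fun i => DistObs.exists_stabilizing_injection (D i).observable α
      exact ⟨Lo, hLo⟩
  refine ⟨?_, hD, hr, fun D r hr => ⟨DistObs.exists_epsCondition hN hobs hconn hr D,
    fun ε hε => ⟨DistObs.exists_gammaCondition D hα hε.1, fun γ hγ => ⟨hLo D, fun Lo hLo =>
      ⟨DistObs.exists_lyapunovCondition hN hr.2.1 hε hγ hLo, fun Po hPo => ?_⟩⟩⟩⟩⟩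
  · obtain ⟨r, hr, -⟩ := hr
    let D := fun i => (hD i).some
    obtain ⟨ε, hε⟩ := DistObs.exists_epsCondition hN hobs hconn hr D
    obtain ⟨γ, hγ⟩ := DistObs.exists_gammaCondition D hα hε.1
    obtain ⟨Lo, hLo⟩ := hLo D
    obtain ⟨Po, hPo⟩ := DistObs.exists_lyapunovCondition hN hr.2.1 hε (hγ γ le_rfl) hLo
    have h := DistObs.errorsDecayAtRate_of_design hε (hγ γ le_rfl) hPo
    exact ⟨r, hr, γ, _, _, DistObs.achievesOmniscience_of_errorsDecayAtRate hα h, h⟩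
  · have h := DistObs.errorsDecayAtRate_of_design hε hγ hPo
    exact ⟨DistObs.achievesOmniscience_of_errorsDecayAtRate hα h, h⟩
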